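/- **Theorem (Uniqueness of strong solutions).** *Setting.* Let $\Omega=\mathbb T^d$ with Lebesgue measure, $T>0$, and $(u,v)=\int_\Omega u\cdot v\,dx$. Let $F:\mathbb R^n\to\mathbb R^{N\times N}_s$ (symmetric matrices) be $C^2$, let $L(\Xi)_i=\sum_{j=0}^{\nu}\sum_{l,m=1}^N\sum_{|\alpha|=j}b_{ilm\alpha}\,\partial_\alpha\Xi_{lm}$, $i=1,\dots,n$, be a differential operator with constant real coefficients acting on fields of symmetric matrices, and let $L^*$ be its formal adjoint, with values in symmetric matrices. Write $A:B$ for the Frobenius product and $|\cdot|$ for the Frobenius norm. Let $\Lambda\subset\mathbb R^{N\times N}_s$ be the smallest linear subspace that contains $I$ and all values $L^*(a)(x)$, $a:\Omega\to\mathbb R^n$ smooth, $x\in\Omega$, and let $\pi_\Lambda$ be the Frobenius-orthogonal projection onto $\Lambda$. Put $K(v)=\frac12\operatorname{tr}(F(v)-F(0))$, $v^\#=\nabla K(v)$, and let $K^*$ be the Legendre transform of $K$. Assume: 1. $K$ is strictly convex and is an $N$-function, i.e. $K\ge 0$ is convex, even, and $\Phi_-(|y|)\le K(y)\le\Phi_+(|y|)$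 for two Young functions $\Phi_\pm$ (convex, even, nonnegative, vanishing only at $0$, $\Phi(s)/s\to0$ as $s\to0$, $\Phi(s)/s\to+\infty$ as $s\to+\infty$); both $K$ and $K^*$ satisfy the $\Delta_2$-condition $K(2y)\le C(K(y)+1)$. 2. For every positive semidefinite $P\in\Lambda$, the function $F:P$ is convex and nonnegative on $\mathbb R^n$. 3. There is $C$ with $|\pi_\Lambda\,\partial_lF(v)|\le C(|\nabla K(v)|+1)$ for all $v\in\mathbb R^n$ and $l=1,\dots,n$. For $Q=\Omega$ or $Q=(0,T)\times\Omega$, $L_K(Q)$ is the space of measurable $f:Q\to\mathbb R^n$ with $\int_QK(f)<\infty$, with the Luxemburg norm $\inf\{\lambda>0:\int_QK(f/\lambda)\le1\}$; $L_{K^*}(Q)$ is defined likewise. Fix a measurable weight $k$ on $[0,T]$ with $0<c\le k\le C<\infty$, and put $\kappa(t)=\int_t^Tk(s)\,ds$. *Solutions.* Let $v_0\in L_K(\Omega)$. A function $v\in L_K((0,T)\times\Omega)$ is a *weak solution* of $$\partial_tv=L(F(v)),\qquad v(0)=v_0,$$ if $\int_0^T[(v-v_0,E)+(F(v),B)]\,dt=0$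 for all $E\in L_{K^*}((0,T)\times\Omega)$ and $B\in L^\infty((0,T)\times\Omega;\mathbb R^{N\times N}_s)$ such that $\int_0^T[(B,\partial_t\Psi)+(E,L\Psi)]\,dt=0$ for all smooth $\Psi:[0,T]\times\Omega\to\mathbb R^{N\times N}_s$ with $\Psi(0)=0$. A weak solution $v$ is a *strong solution* if, with derivatives in the sense of distributions on $(0,T)\times\Omega$, $$\partial_t(\kappa v^\#)\in L_{K^*}((0,T)\times\Omega),\qquad \kappa L^*(v^\#)\in L^\infty((0,T)\times\Omega;\mathbb R^{N\times N}_s),$$ $$\partial_t(v^\#)_l+L^*(v^\#):\partial_lF(v)=0\ \ (l=1,\dots,n)\ \text{ a.e. in }(0,T)\times\Omega,$$ and $v^\#(0,\cdot)=v_0^\#$ a.e. in $\Omega$. The last condition, like every statement about a single time $t\in[0,T)$, refers to the time-continuous representative of $v$, that is, the one for which $v^\#\in C([0,T);L_{K^*}(\Omega))$. *Claim.* Let $u,v$ be two strong solutions with the same initial datum $v_0\in L_K(\Omega)$. Then, for every $t\in[0,T)$, $u(t,\cdot)=v(t,\cdot)$ a.e. in $\Omega$, for the time-continuous representatives of $u$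 and $v$. -/

import Mathlib

open MeasureTheory Filter Set
open scoped Topology ContDiff Gradient

namespace DualEntropy

/-! ### Young functions, N-functions, Orlicz classes -/

/-- The Euclidean space of dimension `n`. -/
abbrev E (n : ℕ) : Type := EuclideanSpace ℝ (Fin n)

/-- Young functions: convex, even, nonnegative, vanishing only at `0`, with `Φ(s)/s → 0` as `s → 0`
and `Φ(s)/s → ∞` as `s → ∞`. -/
structure IsYoung (Φ : ℝ → ℝ) : Prop where
  convex : ConvexOn ℝ univ Φ
  nonneg : ∀ s, 0 ≤ Φ s
  even : ∀ s, Φ (-s) = Φ s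
  eq_zero_iff : ∀ s, Φ s = 0 ↔ s = 0
  lim_zero : Tendsto (fun s => Φ s / s) (𝓝[≠] 0) (𝓝 0)
  lim_top : Tendsto (fun s => Φ s / s) atTop atTop

/-- (Anisotropic) N-functions. -/
structure IsNFunction {n : ℕ} (K : E n → ℝ) : Prop where
  convex : ConvexOn ℝ univ K
  nonneg : ∀ y, 0 ≤ K y
  even : ∀ y, K (-y) = K y
  sandwich : ∃ Φ₁ Φ₂ : ℝ → ℝ, IsYoung Φ₁ ∧ IsYoung Φ₂ ∧ ∀ y, Φ₁ ‖y‖ ≤ K y ∧ K y ≤ Φ₂ ‖y‖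

/-- The `Δ₂`-condition `K(2y) ≲ K(y) + 1`. -/
def DeltaTwo {n : ℕ} (K : E n → ℝ) : Prop :=
  ∃ C : ℝ, ∀ y, K ((2 : ℝ) • y) ≤ C * (K y + 1)

/-- The Legendre transform `K*(y) = sup_v (y · v - K(v))`; for an N-function `K` the supremum is
over a set that is bounded above. -/
noncomputable def legendre {n : ℕ} (K : E n → ℝ) (y : E n) : ℝ :=
  ⨆ v : E n, (inner ℝ y v - K v)

/-- The Orlicz class: measurable functions of finite modular `∫ K(f)` (here `K ≥ 0`). -/
def MemOrlicz {X : Type*} [MeasurableSpace X] {n : ℕ} (K : E n → ℝ) (f : X → E n)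
    (μ : Measure X) : Prop :=
  AEStronglyMeasurable f μ ∧ Integrable (fun x => K (f x)) μ

/-- The Luxemburg norm `inf {r > 0 : ∫ K(f / r) ≤ 1}`. -/
noncomputable def luxNorm {X : Type*} [MeasurableSpace X] {n : ℕ} (K : E n → ℝ) (f : X → E n)
    (μ : Measure X) : ℝ :=
  sInf {r : ℝ | 0 < r ∧ ∫⁻ x, ENNReal.ofReal (K (r⁻¹ • f x)) ∂μ ≤ 1}

/-! ### The torus, smooth fields, and constant-coefficient operators -/

/-- The periodic box `Ω = 𝕋^d`; its `volume` is the Lebesgue measure. -/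
abbrev Torus (d : ℕ) : Type := UnitAddTorus (Fin d)

/-- The quotient map `ℝ^d → 𝕋^d`. -/
def toTorus {d : ℕ} (y : Fin d → ℝ) : Torus d := fun k => (y k : UnitAddCircle)

/-- `N × N` real matrices. -/
abbrev Mat (N : ℕ) : Type := Matrix (Fin N) (Fin N) ℝ

/-- The Frobenius scalar product `A : B`. -/
def frob {N : ℕ} (A B : Mat N) : ℝ := ∑ l, ∑ m, A l m * B l m

/-- The Frobenius norm. -/
noncomputable def frobNorm {N : ℕ} (A : Mat N) : ℝ := Real.sqrt (frob A A)

/-- `∂_k f (x) = d/ds f (x + s e_k)` at `s = 0`, for a function on the torus. -/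
noncomputable def pderiv {d : ℕ} (k : Fin d) (f : Torus d → ℝ) (x : Torus d) : ℝ :=
  deriv (fun s : ℝ => f (x + Pi.single k (s : UnitAddCircle))) 0

/-- `∂_α f` for a multi-index `α`. -/
noncomputable def multiDeriv {d : ℕ} (α : Fin d → ℕ) (f : Torus d → ℝ) : Torus d → ℝ :=
  (List.finRange d).foldr (fun k g => (pderiv k)^[α k] g) f

/-- Smooth vector fields on the torus. -/
def SmoothVec {d n : ℕ} (a : Torus d → E n) : Prop :=
  ContDiff ℝ ∞ fun y : Fin d → ℝ => a (toTorus y)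

/-- Smooth time-dependent vector fields on the torus. -/
def SmoothVecField {d n : ℕ} (a : ℝ → Torus d → E n) : Prop :=
  ContDiff ℝ ∞ fun p : ℝ × (Fin d → ℝ) => a p.1 (toTorus p.2)

/-- Smooth time-dependent fields of symmetric matrices on the torus. -/
def SmoothMatField {d N : ℕ} (Ψ : ℝ → Torus d → Mat N) : Prop :=
  (∀ t x, (Ψ t x).IsSymm) ∧
    ∀ l m, ContDiff ℝ ∞ fun p : ℝ × (Fin d → ℝ) => Ψ p.1 (toTorus p.2) l m

/-- `∂_t Ψ` for a matrix field. -/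
noncomputable def dtMat {d N : ℕ} (Ψ : ℝ → Torus d → Mat N) (t : ℝ) (x : Torus d) : Mat N :=
  Matrix.of fun l m => deriv (fun s => Ψ s x l m) t

/-- The coefficients `b_{ilmα}` of the operator `L`. -/
abbrev Coeff (d n N : ℕ) : Type := Fin n → Fin N → Fin N → (Fin d → ℕ) → ℝ

/-- `L(Ξ)_i = ∑_{j ≤ ν} ∑_{l,m} ∑_{|α| = j} b_{ilmα} ∂_α Ξ_{lm}`. -/
noncomputable def opL {d n N : ℕ} (ν : ℕ) (b : Coeff d n N) (Ξ : Torus d → Mat N)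
    (x : Torus d) : E n :=
  WithLp.toLp 2 fun i => ∑ j ∈ Finset.range (ν + 1), ∑ l, ∑ m,
    ∑ α ∈ Finset.piAntidiag Finset.univ j, b i l m α * multiDeriv α (fun y => Ξ y l m) x

/-- The adjoint `L*` of `L`, as an operator from vector fields to fields of symmetric matrices:
`L*(a)_{lm} = ∑_{j ≤ ν} ∑_i ∑_{|α| = j} (-1)^j (b_{ilmα} + b_{imlα}) / 2 · ∂_α a_i`. -/
noncomputable def opLstar {d n N : ℕ} (ν : ℕ) (b : Coeff d n N) (a : Torus d → E n)
    (x : Torus d) : Mat N :=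
  Matrix.of fun l m => ∑ j ∈ Finset.range (ν + 1), ∑ i,
    ∑ α ∈ Finset.piAntidiag Finset.univ j,
      (-1) ^ j * ((b i l m α + b i m l α) / 2) * multiDeriv α (fun y => a y i) x

/-- The smallest linear space of matrices that contains the identity and all values `L*(a)(x)`,
`a` smooth. All its elements are symmetric. -/
def Lam {d n N : ℕ} (ν : ℕ) (b : Coeff d n N) : Submodule ℝ (Mat N) :=
  Submodule.span ℝ
    ({1} ∪ {A | ∃ (a : Torus d → E n) (x : Torus d), SmoothVec a ∧ A = opLstar ν b a x})

/-! ### The flux, the entropy, and the standing assumptions -/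

/-- The entropy `K(v) = ½ tr (F(v) - F(0))`. -/
noncomputable def entropy {n N : ℕ} (F : E n → Mat N) (v : E n) : ℝ :=
  (1 / 2) * (F v - F 0).trace

/-- `v# = ∇K(v)`. -/
noncomputable def sharp {n N : ℕ} (F : E n → Mat N) (v : E n) : E n := ∇ (entropy F) v

/-- `∂_l F(v)`. -/
noncomputable def partialF {n N : ℕ} (F : E n → Mat N) (l : Fin n) (v : E n) : Mat N :=
  Matrix.of fun i j => fderiv ℝ (fun w => F w i j) v (EuclideanSpace.single l 1)

/-- `Q` is the orthogonal projection of `A` onto `S` for the Frobenius product. -/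
def IsFrobProj {N : ℕ} (S : Submodule ℝ (Mat N)) (A Q : Mat N) : Prop :=
  Q ∈ S ∧ ∀ P ∈ S, frob (A - Q) P = 0

/-- The standing assumptions on the flux `F` and the operator `L` (given by `ν`, `b`). -/
structure Admissible {d n N : ℕ} (ν : ℕ) (b : Coeff d n N) (F : E n → Mat N) : Prop where
  symm : ∀ v, (F v).IsSymm
  smooth : ∀ l m, ContDiff ℝ 2 fun v => F v l m
  strictConvex : StrictConvexOn ℝ univ (entropy F)
  nFunction : IsNFunction (entropy F)
  deltaTwo : DeltaTwo (entropy F)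
  deltaTwo_conj : DeltaTwo (legendre (entropy F))
  /-- `Λ`-convexity of `F` -/
  lamConvex : ∀ P ∈ (Lam ν b : Submodule ℝ (Mat N)), P.PosSemidef →
    ConvexOn ℝ univ fun v => frob (F v) P
  /-- `F ≥ 0` in the `Λ`-order -/
  lamNonneg : ∀ v, ∀ P ∈ (Lam ν b : Submodule ℝ (Mat N)), P.PosSemidef → 0 ≤ frob (F v) P
  /-- `|π_Λ ∂_l F(v)| ≲ |∇K(v)| + 1` -/
  derivBound : ∃ C : ℝ, ∀ v l, ∃ Q : Mat N,
    IsFrobProj (Lam ν b) (partialF F l v) Q ∧ frobNorm Q ≤ C * (‖sharp F v‖ + 1)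

/-! ### Weak solutions -/

/-- The Lebesgue measure on `(s, t) × Ω`. -/
noncomputable def spaceTime (d : ℕ) (s t : ℝ) : Measure (ℝ × Torus d) :=
  (volume.restrict (Ioo s t)).prod volume

/-- `B ∈ L^∞((0,T) × Ω; Sym_N)`. -/
def MemLinftySym {d N : ℕ} (T : ℝ) (B : ℝ × Torus d → Mat N) : Prop :=
  (∀ᵐ p ∂spaceTime d 0 T, (B p).IsSymm) ∧
    ∀ l m, MemLp (fun p => B p l m) ⊤ (spaceTime d 0 T)

/-- The weak form of `∂_t B = L* E`, `B(T) = 0`: for all smooth `Ψ` with `Ψ(0) = 0`,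
`∫₀ᵀ (B, ∂_t Ψ) + (E, L Ψ) dt = 0`. -/
def Constraint {d n N : ℕ} (ν : ℕ) (b : Coeff d n N) (T : ℝ) (e : ℝ × Torus d → E n)
    (B : ℝ × Torus d → Mat N) : Prop :=
  ∀ Ψ : ℝ → Torus d → Mat N, SmoothMatField Ψ → (∀ x, Ψ 0 x = 0) →
    ∫ p, (frob (B p) (dtMat Ψ p.1 p.2) + inner ℝ (e p) (opL ν b (Ψ p.1) p.2))
      ∂spaceTime d 0 T = 0

/-- Weak solutions of `∂_t v = L(F(v))`, `v(0) = v₀` on `(0,T) × Ω`. -/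
def IsWeakSolution {d n N : ℕ} (ν : ℕ) (b : Coeff d n N) (F : E n → Mat N) (T : ℝ)
    (v₀ : Torus d → E n) (v : ℝ × Torus d → E n) : Prop :=
  MemOrlicz (entropy F) v (spaceTime d 0 T) ∧
    ∀ (e : ℝ × Torus d → E n) (B : ℝ × Torus d → Mat N),
      MemOrlicz (legendre (entropy F)) e (spaceTime d 0 T) → MemLinftySym T B →
      Constraint ν b T e B →
      ∫ p, (inner ℝ (v p - v₀ p.2) (e p) + frob (F (v p)) (B p)) ∂spaceTime d 0 T = 0

/-! ### Strong solutions -/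

/-- A weight: positive, bounded away from `0` and `∞` on `[0,T]`. -/
def IsWeight (T : ℝ) (k : ℝ → ℝ) : Prop :=
  AEStronglyMeasurable k (volume.restrict (Icc 0 T)) ∧
    ∃ c C : ℝ, 0 < c ∧ ∀ t ∈ Icc 0 T, c ≤ k t ∧ k t ≤ C

/-- The integrated weight `t ↦ ∫_t^T k`. -/
noncomputable def tailWeight (T : ℝ) (k : ℝ → ℝ) (t : ℝ) : ℝ := ∫ s in t..T, k s

/-- `g = ∂_t f` in the sense of distributions on `(0,T) × Ω`; both are locally integrable. -/
def HasWeakTimeDeriv {d n : ℕ} (T : ℝ) (f g : ℝ × Torus d → E n) : Prop :=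
  (∀ s t, 0 < s → t < T → Integrable f (spaceTime d s t) ∧ Integrable g (spaceTime d s t)) ∧
    ∀ ψ : ℝ → Torus d → E n, SmoothVecField ψ →
      (∃ s t, 0 < s ∧ t < T ∧ ∀ r, r ∉ Icc s t → ∀ x, ψ r x = 0) →
      ∫ p, inner ℝ (f p) (deriv (fun r => ψ r p.2) p.1) ∂spaceTime d 0 T
        = -∫ p, inner ℝ (g p) (ψ p.1 p.2) ∂spaceTime d 0 T

/-- `G = L*(f)` in the sense of distributions on `(0,T) × Ω`; `G` takes symmetric values, and both
are locally integrable. -/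
def HasWeakLstar {d n N : ℕ} (ν : ℕ) (b : Coeff d n N) (T : ℝ) (f : ℝ × Torus d → E n)
    (G : ℝ × Torus d → Mat N) : Prop :=
  (∀ᵐ p ∂spaceTime d 0 T, (G p).IsSymm) ∧
    (∀ s t, 0 < s → t < T →
      Integrable f (spaceTime d s t) ∧ ∀ l m, Integrable (fun p => G p l m) (spaceTime d s t)) ∧
    ∀ Ψ : ℝ → Torus d → Mat N, SmoothMatField Ψ →
      (∃ s t, 0 < s ∧ t < T ∧ ∀ r, r ∉ Icc s t → ∀ x, Ψ r x = 0) →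
      ∫ p, frob (G p) (Ψ p.1 p.2) ∂spaceTime d 0 T
        = ∫ p, inner ℝ (f p) (opL ν b (Ψ p.1) p.2) ∂spaceTime d 0 T

/-- `V` is the time-continuous representative of `v`: `V(t,·) = v(t,·)` a.e. in `Ω` for a.e. `t`,
and `V# ∈ C([0,T); L_{K*}(Ω))`. -/
def IsTimeRep {d n N : ℕ} (F : E n → Mat N) (T : ℝ) (v : ℝ × Torus d → E n)
    (V : ℝ → Torus d → E n) : Prop :=
  (∀ᵐ t ∂volume.restrict (Ioo 0 T), ∀ᵐ x : Torus d, V t x = v (t, x)) ∧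
    (∀ t ∈ Ico 0 T, MemOrlicz (legendre (entropy F)) (fun x => sharp F (V t x)) volume) ∧
    ∀ t ∈ Ico 0 T,
      Tendsto (fun s => luxNorm (legendre (entropy F))
        (fun x => sharp F (V s x) - sharp F (V t x)) volume) (𝓝[Ico 0 T] t) (𝓝 0)

/-- Strong solutions of `∂_t v = L(F(v))`, `v(0) = v₀` on `[0,T)`, with weight `k` and integrated
weight `κ(t) = ∫_t^T k`. The trace `v#(0,·)` is that of the time-continuous representative. -/
structure IsStrongSolution {d n N : ℕ} (ν : ℕ) (b : Coeff d n N) (F : E n → Mat N) (T : ℝ)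
    (k : ℝ → ℝ) (v₀ : Torus d → E n) (v : ℝ × Torus d → E n) : Prop where
  weak : IsWeakSolution ν b F T v₀ v
  /-- `∂_t (κ v#) ∈ L_{K*}((0,T) × Ω)` -/
  timeReg : ∃ g : ℝ × Torus d → E n,
    HasWeakTimeDeriv T (fun p => tailWeight T k p.1 • sharp F (v p)) g ∧
      MemOrlicz (legendre (entropy F)) g (spaceTime d 0 T)
  /-- `κ L*(v#) ∈ L^∞((0,T) × Ω)`, and `∂_t (v#)_l + L*(v#) : ∂_l F(v) = 0` a.e. -/
  equation : ∃ (D : ℝ × Torus d → E n) (G : ℝ × Torus d → Mat N),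
    HasWeakTimeDeriv T (fun p => sharp F (v p)) D ∧
      HasWeakLstar ν b T (fun p => sharp F (v p)) G ∧
      MemLinftySym T (fun p => tailWeight T k p.1 • G p) ∧
      ∀ᵐ p ∂spaceTime d 0 T, ∀ l, D p l + frob (G p) (partialF F l (v p)) = 0
  /-- `v#(0,·) = v₀#` a.e. in `Ω` -/
  initial : ∃ V : ℝ → Torus d → E n, IsTimeRep F T v V ∧
    ∀ᵐ x : Torus d, sharp F (V 0 x) = sharp F (v₀ x)

end DualEntropy

namespace DualEntropy

/-! ### Convex functions -/

/-! The proof is a relative entropy argument in which the strong solutions supply the test pairs.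
For smooth χ(t) vanishing on [T', T], T' < T, the pair (∂_t(χ v#), χ L*(v#)) is admissible in the
weak formulation (`IsStrongSolution.exists_test_pair`). Both u and v can therefore be tested with
the pair built from u and with the pair built from v. In the alternating sum of the four identities
v₀ cancels, and the strong equations eliminate ∂_t u# and ∂_t v#. What remains is ∫ J = 0 with J =
-χ' S + χ (F(u) - F(v) - F'(v)(u - v)) : L*(v#) + χ (F(v) - F(u) - F'(u)(v - u)) : L*(u#), where S =
(u - v) · (u# - v#) is the sum of the relative entropies of u with respect to v and of v with
respect to u. Strict convexity of K makes S positive wherever u ≠ v.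

If A ∈ Λ has entries bounded by M, then A + NM·I is positive semidefinite and lies in Λ, so its
product with F is convex. Since tr F is 2K up to a constant, the first-order remainder of F : A is
at least -2NM times the relative entropy (`Admissible.neg_relEntropy_le`). Hence J ≥ (-χ' - 2NMχ) S,
and a cutoff with χ' ≤ -(2NM + 1) χ gives J ≥ χ S ≥ 0. So S = 0 before T', and T' < T is arbitrary
(`ae_eq_of_lt`).

Three points need analysis. The weight κ is only Lipschitz, so the product rule for ∂_t(κ v#) is
obtained by mollifying k (`weakTimeDeriv_tailWeight`). The distributional L*(v#) must be shown to
take values in Λ, the only place where convexity of F is known (`HasWeakLstar.ae_mem_Lam`).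
Distributional test fields vanish near t = 0, those of the constraint only at t = 0, and a cutoff
closes this gap (`constraint_of_weak`). Finally, equality a.e. in space-time passes to every single
time by continuity in the Luxemburg norm and injectivity of ∇K (`IsTimeRep.ae_eq`). -/

theorem add_fderiv_le_of_convexOn {V : Type*} [NormedAddCommGroup V] [NormedSpace ℝ V] {f : V → ℝ}
    (hf : ConvexOn ℝ univ f) {x : V} (hd : DifferentiableAt ℝ f x) (y : V) :
    f x + fderiv ℝ f x (y - x) ≤ f y := by
  have hline : HasDerivAt (fun t : ℝ => f (x + t • (y - x))) (fderiv ℝ f x (y - x)) 0 := by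
    have h1 : HasDerivAt (fun t : ℝ => x + t • (y - x)) (y - x) 0 := by
      simpa using ((hasDerivAt_id (0 : ℝ)).smul_const (y - x)).const_add x
    have h2 : HasFDerivAt f (fderiv ℝ f x) (x + (0 : ℝ) • (y - x)) := by
      simpa using hd.hasFDerivAt
    exact h2.comp_hasDerivAt 0 h1
  have hlim := hline.tendsto_slope_zero_right
  have : fderiv ℝ f x (y - x) ≤ f y - f x := by
    refine le_of_tendsto hlim ?_
    filter_upwards [Ioc_mem_nhdsGT (zero_lt_one' ℝ)] with t ht
    have hc := hf.2 (mem_univ x) (mem_univ y) (sub_nonneg.2 ht.2) ht.1.le (by ring)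
    have he : (1 - t) • x + t • y = x + (0 + t) • (y - x) := by module
    rw [he] at hc
    simp only [smul_eq_mul, zero_smul, add_zero] at hc ⊢
    rw [inv_mul_le_iff₀ ht.1]
    linarith
  linarith

theorem add_fderiv_lt_of_strictConvexOn {V : Type*} [NormedAddCommGroup V] [NormedSpace ℝ V]
    {f : V → ℝ} (hf : StrictConvexOn ℝ univ f) {x : V} (hd : DifferentiableAt ℝ f x) {y : V}
    (hxy : y ≠ x) : f x + fderiv ℝ f x (y - x) < f y := by
  have h1 := add_fderiv_le_of_convexOn hf.convexOn hd ((1 / 2 : ℝ) • x + (1 / 2 : ℝ) • y)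
  have h2 := hf.2 (mem_univ x) (mem_univ y) hxy.symm (by norm_num : (0 : ℝ) < 1 / 2)
    (by norm_num : (0 : ℝ) < 1 / 2) (by norm_num)
  have he : (1 / 2 : ℝ) • x + (1 / 2 : ℝ) • y - x = (1 / 2 : ℝ) • (y - x) := by module
  rw [he, map_smul] at h1
  simp only [smul_eq_mul] at h1 h2
  linarith

/-- The point a • x lies on the segment from -(R • x) to R • x, and f takes the same value at both
ends. -/
theorem map_smul_le_of_convexOn_even {V : Type*} [AddCommGroup V] [Module ℝ V] {f : V → ℝ}
    (hf : ConvexOn ℝ univ f) (he : ∀ y, f (-y) = f y) {a R : ℝ} (ha : |a| ≤ R) (x : V) :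
    f (a • x) ≤ f (R • x) := by
  rcases (abs_nonneg a).trans ha |>.eq_or_lt with h | h
  · have : a = 0 := by rw [← h] at ha; exact abs_eq_zero.1 (le_antisymm ha (abs_nonneg a))
    simp [this, ← h]
  · have hab := abs_le.1 ha
    have hc := hf.2 (mem_univ (R • x)) (mem_univ (-(R • x)))
      (div_nonneg (by linarith : 0 ≤ R + a) (by linarith : 0 ≤ 2 * R))
      (div_nonneg (by linarith : 0 ≤ R - a) (by linarith : 0 ≤ 2 * R)) (by field_simp; ring)
    have hx : ((R + a) / (2 * R)) • R • x + ((R - a) / (2 * R)) • -(R • x) = a • x := by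
      rw [smul_neg, ← sub_eq_add_neg, smul_smul, smul_smul, ← sub_smul]
      congr 1
      field_simp
      ring
    rw [hx, he, ← add_smul] at hc
    have : (R + a) / (2 * R) + (R - a) / (2 * R) = 1 := by field_simp; ring
    rwa [this, one_smul] at hc

/-! ### N-functions and their Legendre transforms -/

section NFunction

variable {n : ℕ} {K : E n → ℝ}

theorem IsNFunction.map_zero (hK : IsNFunction K) : K 0 = 0 := by
  obtain ⟨Φ₁, Φ₂, -, h₂, h⟩ := hK.sandwich
  refine le_antisymm ?_ (hK.nonneg 0)
  have := (h 0).2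
  rwa [norm_zero, (h₂.eq_zero_iff 0).2 rfl] at this

/-- A real supremum defaults to 0 on an unbounded set, so every estimate of `legendre` from below
rests on this bound. Superlinear growth of Φ₁ gives K v ≥ ‖y‖ ‖v‖ for large v, where the difference
is then nonpositive. -/
theorem IsNFunction.bddAbove (hK : IsNFunction K) (y : E n) :
    BddAbove (range fun v : E n => inner ℝ y v - K v) := by
  obtain ⟨Φ₁, Φ₂, h₁, -, h⟩ := hK.sandwich
  obtain ⟨R, hR⟩ := eventually_atTop.1 (h₁.lim_top.eventually_ge_atTop ‖y‖)
  refine ⟨‖y‖ * (|R| + 1), ?_⟩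
  rintro _ ⟨v, rfl⟩
  have hin := real_inner_le_norm y v
  rcases le_total ‖v‖ (|R| + 1) with hv | hv
  · have := mul_le_mul_of_nonneg_left hv (norm_nonneg y)
    have := hK.nonneg v
    dsimp only
    linarith
  · have hpos : 0 < ‖v‖ := lt_of_lt_of_le (by positivity) hv
    have := hR ‖v‖ (by linarith [le_abs_self R])
    rw [le_div_iff₀ hpos] at this
    have := (h v).1
    have : 0 ≤ ‖y‖ * (|R| + 1) := by positivity
    dsimp only
    linarith

theorem IsNFunction.inner_sub_le (hK : IsNFunction K) (y v : E n) :
    inner ℝ y v - K v ≤ legendre K y :=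
  le_ciSup (hK.bddAbove y) v

theorem IsNFunction.legendre_nonneg (hK : IsNFunction K) (y : E n) : 0 ≤ legendre K y := by
  simpa [hK.map_zero] using hK.inner_sub_le y 0

theorem IsNFunction.abs_inner_le (hK : IsNFunction K) (y v : E n) :
    |inner ℝ v y| ≤ K v + legendre K y := by
  have h1 := hK.inner_sub_le y v
  have h2 := hK.inner_sub_le y (-v)
  rw [inner_neg_right, hK.even] at h2
  rw [real_inner_comm, abs_le]
  constructor <;> linarith

theorem IsNFunction.legendre_zero (hK : IsNFunction K) : legendre K 0 = 0 :=
  le_antisymm (ciSup_le fun v => by simpa using hK.nonneg v) (hK.legendre_nonneg 0)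

theorem IsNFunction.legendre_neg (hK : IsNFunction K) (y : E n) :
    legendre K (-y) = legendre K y := by
  unfold legendre
  refine (Equiv.neg (E n)).iSup_congr fun v => ?_
  simp [hK.even]

/-- Since Φ₂(s)/s → 0, a short vector of length s in the direction of y has ‖y‖ s > Φ₂(s). This is
what lets a vanishing modular of K* force a field to vanish. -/
theorem IsNFunction.legendre_pos (hK : IsNFunction K) {y : E n} (hy : y ≠ 0) :
    0 < legendre K y := by
  obtain ⟨Φ₁, Φ₂, -, h₂, h⟩ := hK.sandwich
  have hy' : 0 < ‖y‖ := norm_pos_iff.2 hy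
  have hlim := h₂.lim_zero.mono_left (nhdsWithin_mono _ fun s (hs : s ∈ Ioi (0 : ℝ)) => hs.ne')
  obtain ⟨s, hs, hs'⟩ := ((hlim.eventually_lt_const hy').and self_mem_nhdsWithin).exists
  have hs0 : 0 < s := hs'
  rw [div_lt_iff₀ hs0] at hs
  refine lt_of_lt_of_le ?_ (hK.inner_sub_le y ((s / ‖y‖) • y))
  have h3 := (h ((s / ‖y‖) • y)).2
  have h4 : ‖(s / ‖y‖) • y‖ = s := by
    rw [norm_smul, Real.norm_of_nonneg (by positivity)]
    field_simp
  rw [h4] at h3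
  have h5 : inner ℝ y ((s / ‖y‖) • y) = ‖y‖ * s := by
    rw [inner_smul_right, real_inner_self_eq_norm_sq]
    field_simp
  rw [h5]
  linarith

theorem IsNFunction.legendre_convexOn (hK : IsNFunction K) : ConvexOn ℝ univ (legendre K) := by
  refine ⟨convex_univ, fun x _ y _ a b ha hb hab => ciSup_le fun v => ?_⟩
  have h1 := mul_le_mul_of_nonneg_left (hK.inner_sub_le x v) ha
  have h2 := mul_le_mul_of_nonneg_left (hK.inner_sub_le y v) hb
  rw [inner_add_left, real_inner_smul_left, real_inner_smul_left]
  have : K v = a * K v + b * K v := by rw [← add_mul, hab, one_mul]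
  simp only [smul_eq_mul]
  linarith

theorem IsNFunction.legendre_continuous (hK : IsNFunction K) : Continuous (legendre K) :=
  continuousOn_univ.1 (hK.legendre_convexOn.continuousOn isOpen_univ)

/-- The supremum is tested at the unit vector y/‖y‖. On a finite measure space this embeds the
Orlicz class of K* in L¹. -/
theorem IsNFunction.exists_norm_le_legendre (hK : IsNFunction K) :
    ∃ C : ℝ, ∀ y, ‖y‖ ≤ legendre K y + C := by
  obtain ⟨Φ₁, Φ₂, -, h₂, h⟩ := hK.sandwich
  refine ⟨Φ₂ 1, fun y => ?_⟩
  rcases eq_or_ne y 0 with rfl | hy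
  · simpa [hK.legendre_zero] using h₂.nonneg 1
  have hy' : 0 < ‖y‖ := norm_pos_iff.2 hy
  have h1 := hK.inner_sub_le y (‖y‖⁻¹ • y)
  have h4 : ‖‖y‖⁻¹ • y‖ = 1 := by
    rw [norm_smul, norm_inv, norm_norm]
    field_simp
  have h3 := (h (‖y‖⁻¹ • y)).2
  rw [h4] at h3
  have h5 : inner ℝ y (‖y‖⁻¹ • y) = ‖y‖ := by
    rw [inner_smul_right, real_inner_self_eq_norm_sq]
    field_simp
  rw [h5] at h1
  linarith

theorem IsNFunction.legendre_gradient (hK : IsNFunction K) {v : E n}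
    (hd : DifferentiableAt ℝ K v) : legendre K (∇ K v) = inner ℝ (∇ K v) v - K v := by
  refine le_antisymm (ciSup_le fun w => ?_) (hK.inner_sub_le _ v)
  have h := add_fderiv_le_of_convexOn hK.convex hd w
  rw [← inner_gradient_left, inner_sub_right] at h
  linarith

/-- The tangent at v is evaluated at 2v. Combined with Δ₂, this sends the Orlicz class of K into
that of K* under v ↦ ∇K(v). -/
theorem IsNFunction.legendre_gradient_le (hK : IsNFunction K) {v : E n}
    (hd : DifferentiableAt ℝ K v) : legendre K (∇ K v) ≤ K ((2 : ℝ) • v) := by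
  rw [hK.legendre_gradient hd]
  have h := add_fderiv_le_of_convexOn hK.convex hd ((2 : ℝ) • v)
  rw [← inner_gradient_left, show (2 : ℝ) • v - v = v by module] at h
  linarith [hK.nonneg v]

end NFunction

/-! ### Orlicz classes -/

section Orlicz

variable {n : ℕ} {K : E n → ℝ} {X : Type*} [MeasurableSpace X] {μ : Measure X}

theorem DeltaTwo.exists_smul_le (hΔ : DeltaTwo K) (hc : ConvexOn ℝ univ K) (hn : ∀ y, 0 ≤ K y)
    (he : ∀ y, K (-y) = K y) (R : ℝ) :
    ∃ C : ℝ, ∀ a : ℝ, |a| ≤ R → ∀ y, K (a • y) ≤ C * (K y + 1) := by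
  obtain ⟨C, hC⟩ := hΔ
  have hC0 : 0 ≤ C := by
    have h1 := (hn _).trans (hC 0)
    have h2 := hn 0
    by_contra! h
    nlinarith
  have hpow : ∀ m : ℕ, ∃ D : ℝ, ∀ y, K ((2 : ℝ) ^ m • y) ≤ D * (K y + 1) := by
    intro m
    induction m with
    | zero => exact ⟨1, fun y => by simp⟩
    | succ m ih =>
      obtain ⟨D, hD⟩ := ih
      refine ⟨C * (D + 1), fun y => ?_⟩
      have h1 := hC ((2 : ℝ) ^ m • y)
      rw [smul_smul, ← pow_succ'] at h1
      have h2 := mul_le_mul_of_nonneg_left (hD y) hC0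
      have h3 := mul_nonneg hC0 (hn y)
      nlinarith
  obtain ⟨m, hm⟩ := pow_unbounded_of_one_lt R (one_lt_two (α := ℝ))
  obtain ⟨D, hD⟩ := hpow m
  exact ⟨D, fun a ha y =>
    (map_smul_le_of_convexOn_even hc he (ha.trans hm.le) y).trans (hD y)⟩

theorem MemOrlicz.congr {f g : X → E n} (hf : MemOrlicz K f μ) (h : f =ᵐ[μ] g) :
    MemOrlicz K g μ :=
  ⟨hf.1.congr h, hf.2.congr (h.fun_comp K)⟩

theorem MemOrlicz.smul [IsFiniteMeasure μ] (hΔ : DeltaTwo K) (hc : ConvexOn ℝ univ K)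
    (hn : ∀ y, 0 ≤ K y) (he : ∀ y, K (-y) = K y) {f : X → E n} (hf : MemOrlicz K f μ)
    {a : X → ℝ} (ha : AEStronglyMeasurable a μ) {R : ℝ} (hR : ∀ᵐ x ∂μ, |a x| ≤ R) :
    MemOrlicz K (fun x => a x • f x) μ := by
  obtain ⟨C, hC⟩ := hΔ.exists_smul_le hc hn he R
  have hcont : Continuous K := continuousOn_univ.1 (hc.continuousOn isOpen_univ)
  refine ⟨ha.smul hf.1, ?_⟩
  refine Integrable.mono' ((hf.2.add (integrable_const 1)).const_mul C)
    (hcont.comp_aestronglyMeasurable (ha.smul hf.1)) ?_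
  filter_upwards [hR] with x hx
  rw [Real.norm_of_nonneg (hn _)]
  exact hC _ hx _

theorem MemOrlicz.add [IsFiniteMeasure μ] (hΔ : DeltaTwo K) (hc : ConvexOn ℝ univ K)
    (hn : ∀ y, 0 ≤ K y) {f g : X → E n} (hf : MemOrlicz K f μ)
    (hg : MemOrlicz K g μ) : MemOrlicz K (fun x => f x + g x) μ := by
  obtain ⟨C, hC⟩ := hΔ
  have hcont : Continuous K := continuousOn_univ.1 (hc.continuousOn isOpen_univ)
  refine ⟨hf.1.add hg.1, ?_⟩
  refine Integrable.mono' ((((hf.2.add (integrable_const 1)).const_mul C).const_mul (1 / 2)).add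
    (((hg.2.add (integrable_const 1)).const_mul C).const_mul (1 / 2)))
    (hcont.comp_aestronglyMeasurable (hf.1.add hg.1)) (ae_of_all _ fun x => ?_)
  rw [Real.norm_of_nonneg (hn _)]
  have h := hc.2 (mem_univ ((2 : ℝ) • f x)) (mem_univ ((2 : ℝ) • g x))
    (by norm_num : (0 : ℝ) ≤ 1 / 2) (by norm_num : (0 : ℝ) ≤ 1 / 2) (by norm_num)
  have he : (1 / 2 : ℝ) • (2 : ℝ) • f x + (1 / 2 : ℝ) • (2 : ℝ) • g x = f x + g x := by module
  rw [he] at h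
  refine h.trans ?_
  have h1 := hC (f x)
  have h2 := hC (g x)
  simp only [smul_eq_mul, Pi.add_apply]
  linarith

theorem MemOrlicz.integrable_legendre [IsFiniteMeasure μ] (hK : IsNFunction K) {f : X → E n}
    (hf : MemOrlicz (legendre K) f μ) : Integrable f μ := by
  obtain ⟨C, hC⟩ := hK.exists_norm_le_legendre
  exact Integrable.mono' (hf.2.add (integrable_const C)) hf.1 (ae_of_all _ fun x => hC (f x))

theorem MemOrlicz.integrable_inner (hK : IsNFunction K) {f g : X → E n}
    (hf : MemOrlicz K f μ) (hg : MemOrlicz (legendre K) g μ) :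
    Integrable (fun x => inner ℝ (f x) (g x)) μ :=
  Integrable.mono' (hf.2.add hg.2) (hf.1.inner hg.1) (ae_of_all _ fun _ => hK.abs_inner_le _ _)

theorem MemOrlicz.gradient [IsFiniteMeasure μ] (hK : IsNFunction K) (hΔ : DeltaTwo K)
    (hC1 : ContDiff ℝ 1 K) {f : X → E n} (hf : MemOrlicz K f μ) :
    MemOrlicz (legendre K) (fun x => ∇ K (f x)) μ := by
  obtain ⟨C, hC⟩ := hΔ
  have hgrad : Continuous (∇ K) :=
    (InnerProductSpace.toDual ℝ (E n)).symm.continuous.comp (hC1.continuous_fderiv one_ne_zero)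
  have hm := hgrad.comp_aestronglyMeasurable hf.1
  refine ⟨hm, Integrable.mono' ((hf.2.add (integrable_const 1)).const_mul C)
    (hK.legendre_continuous.comp_aestronglyMeasurable hm) (ae_of_all _ fun x => ?_)⟩
  rw [Real.norm_of_nonneg (hK.legendre_nonneg _)]
  exact (hK.legendre_gradient_le (hC1.differentiable one_ne_zero _)).trans (hC _)

theorem exists_lintegral_le_one_of_luxNorm_lt {f : X → E n} (hc : ConvexOn ℝ univ K)
    (hn : ∀ y, 0 ≤ K y) (h0 : K 0 = 0) (hf : MemOrlicz K f μ) {r : ℝ}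
    (hr : luxNorm K f μ < r) : ∫⁻ x, ENNReal.ofReal (K (r⁻¹ • f x)) ∂μ ≤ 1 := by
  have hscale : ∀ a : ℝ, 0 ≤ a → a ≤ 1 → ∀ y, K (a • y) ≤ a * K y := fun a ha ha1 y => by
    have h := hc.2 (mem_univ y) (mem_univ 0) ha (sub_nonneg.2 ha1) (by ring)
    simpa [h0] using h
  -- Since `sInf ∅ = 0`, a small `luxNorm` carries no information until some admissible radius is
  -- exhibited; 1 + ∫ K(f) is one, by convexity and K(0) = 0.
  have hne : {r : ℝ | 0 < r ∧ ∫⁻ x, ENNReal.ofReal (K (r⁻¹ • f x)) ∂μ ≤ 1}.Nonempty := by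
    set I := ∫ x, K (f x) ∂μ with hI
    have hI0 : 0 ≤ I := integral_nonneg fun x => hn _
    refine ⟨I + 1, by linarith, ?_⟩
    have hb : ∀ x, ENNReal.ofReal (K ((I + 1)⁻¹ • f x)) ≤
        ENNReal.ofReal ((I + 1)⁻¹ * K (f x)) := fun x =>
      ENNReal.ofReal_le_ofReal (hscale _ (by positivity) (inv_le_one_of_one_le₀ (by linarith)) _)
    refine (lintegral_mono hb).trans ?_
    rw [← ofReal_integral_eq_lintegral_ofReal (hf.2.const_mul _)
      (ae_of_all _ fun x => mul_nonneg (by positivity) (hn _)), integral_const_mul, ← hI]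
    rw [ENNReal.ofReal_le_one, inv_mul_le_iff₀ (by linarith)]
    linarith
  obtain ⟨s, ⟨hs0, hs⟩, hsr⟩ := exists_lt_of_csInf_lt hne hr
  refine (lintegral_mono fun x => ENNReal.ofReal_le_ofReal ?_).trans hs
  have hr0 := hs0.trans hsr
  have h := hscale (s / r) (by positivity) ((div_le_one hr0).2 hsr.le) (s⁻¹ • f x)
  have he : (s / r) • s⁻¹ • f x = r⁻¹ • f x := by
    rw [smul_smul]
    congr 1
    field_simp
  rw [he] at h
  exact h.trans (mul_le_of_le_one_left (hn _) ((div_le_one hr0).2 hsr.le))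

/-- A substitute for the triangle inequality of the Luxemburg norm: w/(2r) is the midpoint of g/r
and -f/r, whose modulars are at most 1, so ∫ K(w) ≤ 2r for all small r. -/
theorem ae_eq_of_luxNorm_lt (hc : ConvexOn ℝ univ K) (hn : ∀ y, 0 ≤ K y) (h0 : K 0 = 0)
    (he : ∀ y, K (-y) = K y) (hpos : ∀ y, y ≠ 0 → 0 < K y) {w : X → E n}
    (hw : AEStronglyMeasurable w μ)
    (h : ∀ r : ℝ, 0 < r → ∃ f g : X → E n, MemOrlicz K f μ ∧ MemOrlicz K g μ ∧
      luxNorm K f μ < r ∧ luxNorm K g μ < r ∧ ∀ᵐ x ∂μ, w x = g x - f x) :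
    ∀ᵐ x ∂μ, w x = 0 := by
  have hcont : Continuous K := continuousOn_univ.1 (hc.continuousOn isOpen_univ)
  have hscale : ∀ a : ℝ, 0 ≤ a → a ≤ 1 → ∀ y, K (a • y) ≤ a * K y := fun a ha ha1 y => by
    have h := hc.2 (mem_univ y) (mem_univ 0) ha (sub_nonneg.2 ha1) (by ring)
    simpa [h0] using h
  have key : ∀ r : ℝ, 0 < r → r ≤ 1 / 2 →
      ∫⁻ x, ENNReal.ofReal (K (w x)) ∂μ ≤ ENNReal.ofReal (2 * r) := by
    intro r hr hr1
    obtain ⟨f, g, hf, hg, hfr, hgr, hwfg⟩ := h r hr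
    have h1 := exists_lintegral_le_one_of_luxNorm_lt hc hn h0 hf hfr
    have h2 := exists_lintegral_le_one_of_luxNorm_lt hc hn h0 hg hgr
    have hb : ∀ᵐ x ∂μ, ENNReal.ofReal (K (w x)) ≤ ENNReal.ofReal r *
        (ENNReal.ofReal (K (r⁻¹ • f x)) + ENNReal.ofReal (K (r⁻¹ • g x))) := by
      filter_upwards [hwfg] with x hx
      rw [← ENNReal.ofReal_add (hn _) (hn _), ← ENNReal.ofReal_mul hr.le]
      refine ENNReal.ofReal_le_ofReal ?_
      have h3 := hscale (2 * r) (by linarith) (by linarith) ((1 / 2 : ℝ) • (r⁻¹ • g x) +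
        (1 / 2 : ℝ) • -(r⁻¹ • f x))
      have h4 := hc.2 (mem_univ (r⁻¹ • g x)) (mem_univ (-(r⁻¹ • f x)))
        (by norm_num : (0 : ℝ) ≤ 1 / 2) (by norm_num : (0 : ℝ) ≤ 1 / 2) (by norm_num)
      have h5 : (2 * r) • ((1 / 2 : ℝ) • (r⁻¹ • g x) + (1 / 2 : ℝ) • -(r⁻¹ • f x)) = w x := by
        rw [hx, ← smul_neg, smul_smul, smul_smul, smul_add, smul_smul, smul_smul, sub_eq_add_neg]
        have : 2 * r * (1 / 2 * r⁻¹) = 1 := by field_simp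
        rw [this, one_smul, one_smul]
      rw [h5] at h3
      rw [he] at h4
      simp only [smul_eq_mul] at h4
      have := mul_le_mul_of_nonneg_left h4 (by linarith : 0 ≤ 2 * r)
      linarith
    refine (lintegral_mono_ae hb).trans ?_
    have hmf : AEMeasurable (fun x => ENNReal.ofReal (K (r⁻¹ • f x))) μ :=
      (hcont.comp_aestronglyMeasurable (hf.1.const_smul r⁻¹)).aemeasurable.ennreal_ofReal
    rw [lintegral_const_mul' _ _ ENNReal.ofReal_ne_top, lintegral_add_left' hmf]
    calc ENNReal.ofReal r * _ ≤ ENNReal.ofReal r * (1 + 1) := by gcongr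
      _ = ENNReal.ofReal (2 * r) := by
        rw [mul_comm 2 r, ENNReal.ofReal_mul hr.le, one_add_one_eq_two]
        simp
  have hz : ∫⁻ x, ENNReal.ofReal (K (w x)) ∂μ = 0 := by
    refine le_antisymm ?_ bot_le
    have hlim : Tendsto (fun r : ℝ => ENNReal.ofReal (2 * r)) (𝓝[>] 0) (𝓝 0) := by
      have : Continuous fun r : ℝ => ENNReal.ofReal (2 * r) :=
        ENNReal.continuous_ofReal.comp (continuous_const.mul continuous_id)
      simpa using (this.tendsto 0).mono_left nhdsWithin_le_nhds
    refine ge_of_tendsto hlim ?_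
    filter_upwards [Ioc_mem_nhdsGT (by norm_num : (0 : ℝ) < 1 / 2)] with r hr
    exact key r hr.1 hr.2
  rw [lintegral_eq_zero_iff' (hcont.comp_aestronglyMeasurable hw).aemeasurable.ennreal_ofReal] at hz
  filter_upwards [hz] with x hx
  by_contra hne
  have := hpos _ hne
  simp only [Pi.zero_apply, ENNReal.ofReal_eq_zero] at hx
  linarith

end Orlicz

/-! ### Smooth time-dependent fields on the torus -/

section SmoothFields

variable {d : ℕ}

theorem isOpenQuotientMap_toTorus : IsOpenQuotientMap (toTorus : (Fin d → ℝ) → Torus d) :=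
  IsOpenQuotientMap.piMap fun _ => QuotientAddGroup.isOpenQuotientMap_mk

theorem toTorus_add_single (y : Fin d → ℝ) (k : Fin d) (s : ℝ) :
    toTorus y + Pi.single k (s : UnitAddCircle) = toTorus (y + Pi.single k s) := by
  ext j
  rcases eq_or_ne j k with rfl | h
  · simp [toTorus]
  · simp [toTorus, h]

theorem hasDerivAt_euclidean {n : ℕ} {f : ℝ → E n} {f' : E n} {t : ℝ}
    (h : ∀ i, HasDerivAt (fun s => f s i) (f' i) t) : HasDerivAt f f' t := by
  rw [← hasDerivWithinAt_univ, hasDerivWithinAt_iff_hasFDerivWithinAt,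
    hasFDerivWithinAt_euclidean]
  intro i
  exact (h i).hasFDerivAt.hasFDerivWithinAt.congr_fderiv (by ext; simp)

/-- Smooth time-dependent fields on the torus with values in a normed space. -/
def SmoothField {V : Type*} [NormedAddCommGroup V] [NormedSpace ℝ V] (f : ℝ → Torus d → V) :
    Prop :=
  ContDiff ℝ ∞ fun p : ℝ × (Fin d → ℝ) => f p.1 (toTorus p.2)

variable {V : Type*} [NormedAddCommGroup V] [NormedSpace ℝ V]

theorem SmoothField.continuous {f : ℝ → Torus d → V} (hf : SmoothField f) :
    Continuous fun p : ℝ × Torus d => f p.1 p.2 := by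
  rw [← (IsOpenQuotientMap.id.prodMap isOpenQuotientMap_toTorus).continuous_comp_iff]
  exact ContDiff.continuous hf

theorem SmoothField.exists_bound {f : ℝ → Torus d → V} (hf : SmoothField f) (s t : ℝ) :
    ∃ C : ℝ, ∀ r ∈ Icc s t, ∀ x, ‖f r x‖ ≤ C := by
  obtain ⟨C, hC⟩ := (isCompact_Icc (a := s) (b := t)).prod (isCompact_univ (X := Torus d))
    |>.exists_bound_of_continuousOn hf.continuous.continuousOn
  exact ⟨C, fun r hr x => hC (r, x) ⟨hr, mem_univ x⟩⟩

theorem SmoothField.smul {f : ℝ → Torus d → V} (hf : SmoothField f) {c : ℝ → ℝ}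
    (hc : ContDiff ℝ ∞ c) : SmoothField fun t x => c t • f t x :=
  (hc.comp contDiff_fst).smul hf

theorem SmoothField.hasFDerivAt {f : ℝ → Torus d → V} (hf : SmoothField f)
    (p : ℝ × (Fin d → ℝ)) :
    HasFDerivAt (fun p : ℝ × (Fin d → ℝ) => f p.1 (toTorus p.2))
      (fderiv ℝ (fun p : ℝ × (Fin d → ℝ) => f p.1 (toTorus p.2)) p) p :=
  (ContDiff.differentiable hf (by simp) p).hasFDerivAt

theorem SmoothField.hasDerivAt_toTorus {f : ℝ → Torus d → V} (hf : SmoothField f) (t : ℝ)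
    (y : Fin d → ℝ) : HasDerivAt (fun s => f s (toTorus y))
      (fderiv ℝ (fun p : ℝ × (Fin d → ℝ) => f p.1 (toTorus p.2)) (t, y) (1, 0)) t :=
  HasFDerivAt.comp_hasDerivAt (l := fun p : ℝ × (Fin d → ℝ) => f p.1 (toTorus p.2))
    (f := fun s => (s, y)) t (hf.hasFDerivAt (t, y)) ((hasDerivAt_id t).prodMk (hasDerivAt_const t y))

theorem SmoothField.hasDerivAt {f : ℝ → Torus d → V} (hf : SmoothField f) (t : ℝ)
    (x : Torus d) : HasDerivAt (fun s => f s x) (deriv (fun s => f s x) t) t := by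
  obtain ⟨y, rfl⟩ := isOpenQuotientMap_toTorus.surjective x
  exact (hf.hasDerivAt_toTorus t y).differentiableAt.hasDerivAt

theorem SmoothField.deriv {f : ℝ → Torus d → V} (hf : SmoothField f) :
    SmoothField fun t x => deriv (fun s => f s x) t := by
  have h : ContDiff ℝ ∞ fun p : ℝ × (Fin d → ℝ) =>
      fderiv ℝ (fun p : ℝ × (Fin d → ℝ) => f p.1 (toTorus p.2)) p (1, 0) :=
    (ContDiff.fderiv_right hf (by simp)).clm_apply contDiff_const
  have he : (fun p : ℝ × (Fin d → ℝ) => _root_.deriv (fun s => f s (toTorus p.2)) p.1) = _ :=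
    funext fun p => (hf.hasDerivAt_toTorus p.1 p.2).deriv
  rw [SmoothField, he]
  exact h

theorem SmoothField.pderiv_toTorus {f : ℝ → Torus d → ℝ} (hf : SmoothField f) (k : Fin d) (t : ℝ)
    (y : Fin d → ℝ) : pderiv k (f t) (toTorus y) =
      fderiv ℝ (fun p : ℝ × (Fin d → ℝ) => f p.1 (toTorus p.2)) (t, y) (0, Pi.single k 1) := by
  have h1 : HasDerivAt (fun s : ℝ => (t, y + Pi.single k s)) (0, Pi.single k (1 : ℝ)) 0 := by
    refine (hasDerivAt_const _ t).prodMk ?_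
    simpa using ((ContinuousLinearMap.single ℝ (fun _ : Fin d => ℝ) k).hasDerivAt
      (x := (0 : ℝ))).const_add y
  have h2 := hf.hasFDerivAt (t, y + Pi.single k 0)
  have h3 := h2.comp_hasDerivAt (0 : ℝ) h1
  simp only [Pi.single_zero, add_zero] at h3
  unfold pderiv
  simp only [toTorus_add_single]
  exact h3.deriv

theorem SmoothField.pderiv {f : ℝ → Torus d → ℝ} (hf : SmoothField f) (k : Fin d) :
    SmoothField fun t => pderiv k (f t) := by
  have h : ContDiff ℝ ∞ fun p : ℝ × (Fin d → ℝ) =>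
      fderiv ℝ (fun p : ℝ × (Fin d → ℝ) => f p.1 (toTorus p.2)) p (0, Pi.single k 1) :=
    (ContDiff.fderiv_right hf (by simp)).clm_apply contDiff_const
  have he : (fun p : ℝ × (Fin d → ℝ) => DualEntropy.pderiv k (f p.1) (toTorus p.2)) = _ :=
    funext fun p => hf.pderiv_toTorus k p.1 p.2
  rw [SmoothField, he]
  exact h

theorem SmoothField.pderiv_deriv {f : ℝ → Torus d → ℝ} (hf : SmoothField f) (k : Fin d) (t : ℝ)
    (x : Torus d) : DualEntropy.pderiv k (fun x => _root_.deriv (fun s => f s x) t) x =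
      _root_.deriv (fun s => DualEntropy.pderiv k (f s) x) t := by
  obtain ⟨y, rfl⟩ := isOpenQuotientMap_toTorus.surjective x
  set g : ℝ × (Fin d → ℝ) → ℝ := fun p => f p.1 (toTorus p.2) with hg
  have hg1 : Differentiable ℝ (fderiv ℝ g) :=
    (ContDiff.fderiv_right (m := ∞) hf (by simp)).differentiable (by simp)
  have hap : ∀ (w z : ℝ × (Fin d → ℝ)) p, fderiv ℝ (fun p => fderiv ℝ g p w) p z =
      fderiv ℝ (fderiv ℝ g) p z w := fun w z p => by
    rw [fderiv_clm_apply (hg1 p) (differentiableAt_const w)]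
    simp
  have e1 : (fun p : ℝ × (Fin d → ℝ) => _root_.deriv (fun s => f s (toTorus p.2)) p.1) =
      fun p => fderiv ℝ g p (1, 0) :=
    funext fun p => (hf.hasDerivAt_toTorus p.1 p.2).deriv
  have e2 : (fun p : ℝ × (Fin d → ℝ) => DualEntropy.pderiv k (f p.1) (toTorus p.2)) =
      fun p => fderiv ℝ g p (0, Pi.single k 1) :=
    funext fun p => hf.pderiv_toTorus k p.1 p.2
  have h1 := hf.deriv.pderiv_toTorus k t y
  rw [e1, hap] at h1
  have h2 := ((hf.pderiv k).hasDerivAt_toTorus t y).deriv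
  rw [e2, hap] at h2
  rw [h1, h2]
  -- Both sides are now mixed second derivatives of the lift of f to ℝ × ℝ^d.
  have hsymm : IsSymmSndFDerivAt ℝ g (t, y) :=
    (ContDiff.contDiffAt hf).isSymmSndFDerivAt (by simpa using WithTop.coe_le_coe.2 (le_top (a := (2 : ℕ∞))))
  exact hsymm _ _

/-- An operator on fields on the torus that preserves smoothness and commutes with `∂_t` and with
multiplication by constants. -/
structure IsSpatial (D : (Torus d → ℝ) → Torus d → ℝ) : Prop where
  const_mul : ∀ (c : ℝ) f x, D (fun y => c * f y) x = c * D f x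
  smooth : ∀ f : ℝ → Torus d → ℝ, SmoothField f → SmoothField fun t => D (f t)
  deriv : ∀ f : ℝ → Torus d → ℝ, SmoothField f → ∀ t x,
    D (fun x => _root_.deriv (fun s => f s x) t) x = _root_.deriv (fun s => D (f s) x) t

theorem IsSpatial.id : IsSpatial (fun f : Torus d → ℝ => f) :=
  ⟨fun _ _ _ => rfl, fun _ hf => hf, fun _ _ _ _ => rfl⟩

theorem IsSpatial.pderiv_comp {D : (Torus d → ℝ) → Torus d → ℝ} (hD : IsSpatial D) (k : Fin d) :
    IsSpatial fun f => pderiv k (D f) where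
  const_mul c f x := by
    have : D (fun y => c * f y) = fun y => c * D f y := funext (hD.const_mul c f)
    unfold pderiv
    rw [this]
    exact deriv_const_mul_field c
  smooth f hf := (hD.smooth f hf).pderiv k
  deriv f hf t x := by
    have : D (fun x => _root_.deriv (fun s => f s x) t) =
        fun x => _root_.deriv (fun s => D (f s) x) t := funext (hD.deriv f hf t)
    rw [this]
    exact (hD.smooth f hf).pderiv_deriv k t x

theorem isSpatial_multiDeriv (α : Fin d → ℕ) : IsSpatial (multiDeriv α) := by
  unfold multiDeriv
  induction List.finRange d with
  | nil => exact IsSpatial.id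
  | cons k l ih =>
    simp only [List.foldr_cons]
    induction α k with
    | zero => exact ih
    | succ m ihm =>
      simp only [Function.iterate_succ', Function.comp_apply]
      exact ihm.pderiv_comp k

theorem pderiv_comp_neg (k : Fin d) (f : Torus d → ℝ) (x : Torus d) :
    pderiv k (fun y => f (-y)) x = -pderiv k f (-x) := by
  unfold pderiv
  have h := deriv_comp_neg (fun s : ℝ => f (-x + Pi.single k (s : UnitAddCircle))) 0
  rw [neg_zero] at h
  rw [← h]
  congr 1
  ext s
  dsimp only
  congr 1
  rw [neg_add, AddCircle.coe_neg, Pi.single_neg]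

/-- The parity produced by the reflection y ↦ -y cancels the sign (-1)^j in `opLstar`, so that L can
be read off from L* of a reflected field without integrating by parts. -/
theorem multiDeriv_comp_neg (α : Fin d → ℕ) (f : Torus d → ℝ) (x : Torus d) :
    multiDeriv α (fun y => f (-y)) x = (-1) ^ (∑ k, α k) * multiDeriv α f (-x) := by
  have hsum : ∑ k, α k = ((List.finRange d).map α).sum := (List.sum_ofFn.symm.trans (by
    rw [List.ofFn_eq_map]))
  rw [hsum]
  unfold multiDeriv
  induction List.finRange d generalizing x with
  | nil => simp
  | cons k l ih =>
    simp only [List.foldr_cons, List.map_cons, List.sum_cons]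
    generalize α k = m
    induction m generalizing x with
    | zero => simpa using ih x
    | succ m ihm =>
      simp only [Function.iterate_succ', Function.comp_apply]
      rw [show (pderiv k)^[m] (List.foldr (fun k g => (pderiv k)^[α k] g) (fun y => f (-y)) l) =
        fun y => (-1) ^ (m + (l.map α).sum) *
          (pderiv k)^[m] (List.foldr (fun k g => (pderiv k)^[α k] g) f l) (-y) from funext ihm]
      rw [(IsSpatial.id.pderiv_comp k).const_mul _
        (fun y => (pderiv k)^[m] (List.foldr (fun k g => (pderiv k)^[α k] g) f l) (-y)) x,
        pderiv_comp_neg]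
      ring

end SmoothFields

/-! ### The operators `L` and `L*` -/

section Operators

variable {d n N : ℕ} (ν : ℕ) (b : Coeff d n N)

theorem SmoothMatField.entry {Ψ : ℝ → Torus d → Mat N} (h : SmoothMatField Ψ) (l m : Fin N) :
    SmoothField fun t x => Ψ t x l m := h.2 l m

theorem SmoothMatField.smul {Ψ : ℝ → Torus d → Mat N} (h : SmoothMatField Ψ) {c : ℝ → ℝ}
    (hc : ContDiff ℝ ∞ c) : SmoothMatField fun t x => c t • Ψ t x :=
  ⟨fun t x => (h.1 t x).smul _, fun l m => (h.entry l m).smul hc⟩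

theorem SmoothMatField.dtMat {Ψ : ℝ → Torus d → Mat N} (h : SmoothMatField Ψ) :
    SmoothMatField (dtMat Ψ) := by
  refine ⟨fun t x => ?_, fun l m => (h.entry l m).deriv⟩
  ext l m
  simp only [Matrix.transpose_apply, DualEntropy.dtMat, Matrix.of_apply]
  congr 1
  ext s
  exact (h.1 s x).apply l m

theorem opL_smul (c : ℝ) (Ξ : Torus d → Mat N) (x : Torus d) :
    opL ν b (fun y => c • Ξ y) x = c • opL ν b Ξ x := by
  ext i
  simp only [opL, PiLp.smul_apply, smul_eq_mul, Finset.mul_sum, Matrix.smul_apply]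
  refine Finset.sum_congr rfl fun j _ => Finset.sum_congr rfl fun l _ =>
    Finset.sum_congr rfl fun m _ => Finset.sum_congr rfl fun α _ => ?_
  rw [(isSpatial_multiDeriv α).const_mul c (fun y => Ξ y l m)]
  ring

theorem SmoothMatField.opL {Ψ : ℝ → Torus d → Mat N} (h : SmoothMatField Ψ) :
    SmoothField fun t => opL ν b (Ψ t) := by
  unfold SmoothField
  rw [contDiff_euclidean]
  intro i
  simp only [DualEntropy.opL]
  refine ContDiff.sum fun j _ => ContDiff.sum fun l _ => ContDiff.sum fun m _ =>
    ContDiff.sum fun α _ => contDiff_const.mul ?_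
  exact (isSpatial_multiDeriv α).smooth _ (h.entry l m)

theorem SmoothMatField.hasDerivAt_opL {Ψ : ℝ → Torus d → Mat N} (h : SmoothMatField Ψ) (t : ℝ)
    (x : Torus d) : HasDerivAt (fun s => DualEntropy.opL ν b (Ψ s) x)
      (DualEntropy.opL ν b (DualEntropy.dtMat Ψ t) x) t := by
  refine hasDerivAt_euclidean fun i => ?_
  simp only [DualEntropy.opL]
  refine HasDerivAt.fun_sum fun j _ => HasDerivAt.fun_sum fun l _ => HasDerivAt.fun_sum fun m _ =>
    HasDerivAt.fun_sum fun α _ => HasDerivAt.const_mul _ ?_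
  have h1 := ((isSpatial_multiDeriv α).smooth _ (h.entry l m)).hasDerivAt t x
  rwa [← (isSpatial_multiDeriv α).deriv _ (h.entry l m) t x] at h1

theorem frob_add_left (A B P : Mat N) : frob (A + B) P = frob A P + frob B P := by
  simp [frob, add_mul, Finset.sum_add_distrib]

theorem frob_smul_left (c : ℝ) (A P : Mat N) : frob (c • A) P = c * frob A P := by
  simp [frob, mul_assoc, Finset.mul_sum]

theorem frob_comm (A B : Mat N) : frob A B = frob B A := by
  simp [frob, mul_comm]

theorem frob_smul_right (c : ℝ) (A P : Mat N) : frob A (c • P) = c * frob A P := by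
  rw [frob_comm, frob_smul_left, frob_comm]

theorem frob_add_right (A P Q : Mat N) : frob A (P + Q) = frob A P + frob A Q := by
  rw [frob_comm, frob_add_left, frob_comm, frob_comm Q]

theorem frob_transpose_right (A B : Mat N) : frob A B.transpose = frob A.transpose B := by
  unfold frob
  rw [Finset.sum_comm]
  rfl

theorem frob_one_right (A : Mat N) : frob A 1 = A.trace := by
  simp [frob, Matrix.trace, Matrix.one_apply]

theorem Lam_isSymm {A : Mat N} (hA : A ∈ Lam ν b) : A.IsSymm := by
  induction hA using Submodule.span_induction with
  | mem A h =>
    rcases h with h | ⟨a, x, -, rfl⟩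
    · rw [mem_singleton_iff.1 h]; exact Matrix.isSymm_one
    · ext l m
      simp only [opLstar, Matrix.transpose_apply, Matrix.of_apply, add_comm]
  | zero => exact Matrix.isSymm_zero
  | add A B _ _ hA hB => exact hA.add hB
  | smul c A _ hA => exact hA.smul c

/-- The i-th component of L(φP) at x equals L*(a)(-x) : P for the reflected field a(y) = φ(-y) e_i,
and the value L*(a)(-x) belongs to Λ. -/
theorem opL_smul_eq_zero {P : Mat N} (hP : P.IsSymm) (hPL : ∀ A ∈ Lam ν b, frob A P = 0)
    {φ : Torus d → ℝ} (hφ : ContDiff ℝ ∞ fun y : Fin d → ℝ => φ (toTorus y)) (x : Torus d) :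
    opL ν b (fun y => φ y • P) x = 0 := by
  ext i
  have hneg : ContDiff ℝ ∞ fun y : Fin d → ℝ => φ (-toTorus y) := by
    have he : (fun y : Fin d → ℝ => φ (-toTorus y)) = (fun y => φ (toTorus y)) ∘ fun y => -y := by
      ext y
      simp only [Function.comp_apply]
      congr 1
    rw [he]
    exact hφ.comp contDiff_neg
  set a : Torus d → E n := fun y => EuclideanSpace.single i (φ (-y)) with ha
  have hsm : SmoothVec a := by
    unfold SmoothVec
    rw [contDiff_euclidean]
    intro i'
    simp only [ha, PiLp.single_apply]
    split_ifs with h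
    · exact hneg
    · exact contDiff_const
  have h0 := hPL _ (Submodule.subset_span (Or.inr ⟨a, -x, hsm, rfl⟩))
  have hterm : ∀ j, ∀ α ∈ Finset.piAntidiag (Finset.univ : Finset (Fin d)) j, ∀ i',
      (-1) ^ j * multiDeriv α (fun y => a y i') (-x) =
        if i' = i then multiDeriv α φ x else 0 := by
    intro j α hα i'
    have hj : ∑ k, α k = j := (Finset.mem_piAntidiag.1 hα).1
    split_ifs with h
    · have : (fun y => a y i') = fun y => φ (-y) := by
        ext y; simp [ha, h]
      rw [this, multiDeriv_comp_neg, hj, neg_neg, ← mul_assoc, ← mul_pow]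
      simp
    · have : (fun y => a y i') = fun y => 0 * φ y := by
        ext y; simp [ha, h]
      rw [this, (isSpatial_multiDeriv α).const_mul]
      simp
  have h1 : frob (opLstar ν b a (-x)) P = ∑ l, ∑ m, ∑ j ∈ Finset.range (ν + 1),
      ∑ α ∈ Finset.piAntidiag Finset.univ j,
        (b i l m α + b i m l α) / 2 * P l m * multiDeriv α φ x := by
    unfold frob opLstar
    refine Finset.sum_congr rfl fun l _ => Finset.sum_congr rfl fun m _ => ?_
    simp only [Matrix.of_apply]
    rw [Finset.sum_mul]
    refine Finset.sum_congr rfl fun j _ => ?_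
    rw [Finset.sum_eq_single i]
    · rw [Finset.sum_mul]
      refine Finset.sum_congr rfl fun α hα => ?_
      have h := hterm j α hα i
      rw [if_pos rfl] at h
      rw [← h]
      ring
    · intro i' _ hi'
      refine Finset.sum_eq_zero fun α hα => ?_
      have h := hterm j α hα i'
      rw [if_neg hi'] at h
      linear_combination ((b i' l m α + b i' m l α) / 2) * h
    · simp
  have h2 : (opL ν b (fun y => φ y • P) x) i = ∑ l, ∑ m, ∑ j ∈ Finset.range (ν + 1),
      ∑ α ∈ Finset.piAntidiag Finset.univ j, b i l m α * P l m * multiDeriv α φ x := by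
    simp only [opL, Matrix.smul_apply, smul_eq_mul]
    rw [Finset.sum_comm]
    refine Finset.sum_congr rfl fun l _ => ?_
    rw [Finset.sum_comm]
    refine Finset.sum_congr rfl fun m _ => Finset.sum_congr rfl fun j _ =>
      Finset.sum_congr rfl fun α _ => ?_
    have := (isSpatial_multiDeriv α).const_mul (P l m) φ x
    simp only [mul_comm (P l m)] at this
    rw [this]
    ring
  -- Exchanging l and m and using the symmetry of P shows that the symmetrised coefficients of L*
  -- and the raw coefficients of L give the same sum.
  have h3 : ∑ l, ∑ m, ∑ j ∈ Finset.range (ν + 1), ∑ α ∈ Finset.piAntidiag Finset.univ j,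
      b i m l α * P l m * multiDeriv α φ x = ∑ l, ∑ m, ∑ j ∈ Finset.range (ν + 1),
      ∑ α ∈ Finset.piAntidiag Finset.univ j, b i l m α * P l m * multiDeriv α φ x := by
    rw [Finset.sum_comm]
    refine Finset.sum_congr rfl fun l _ => Finset.sum_congr rfl fun m _ => ?_
    rw [hP.apply l m]
  rw [h2]
  rw [h0] at h1
  have h4 : ∑ l, ∑ m, ∑ j ∈ Finset.range (ν + 1), ∑ α ∈ Finset.piAntidiag Finset.univ j,
      (b i l m α + b i m l α) / 2 * P l m * multiDeriv α φ x =
      (1 / 2) * (∑ l, ∑ m, ∑ j ∈ Finset.range (ν + 1),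
        ∑ α ∈ Finset.piAntidiag Finset.univ j, b i l m α * P l m * multiDeriv α φ x) +
      (1 / 2) * ∑ l, ∑ m, ∑ j ∈ Finset.range (ν + 1),
        ∑ α ∈ Finset.piAntidiag Finset.univ j, b i m l α * P l m * multiDeriv α φ x := by
    simp only [Finset.mul_sum, ← Finset.sum_add_distrib]
    refine Finset.sum_congr rfl fun l _ => Finset.sum_congr rfl fun m _ =>
      Finset.sum_congr rfl fun j _ => Finset.sum_congr rfl fun α _ => ?_
    ring
  rw [h4, h3] at h1
  simp only [PiLp.zero_apply]
  linarith

end Operators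

/-! ### The fundamental lemma of the calculus of variations on `(0,T) × Ω` -/

/-- The positive and negative parts of h are densities of two finite measures with equal integrals
over an algebra that separates points. On a Polish space such measures coincide, hence so do the
densities. -/
theorem ae_eq_zero_of_forall_integral_mul_eq_zero {X : Type*} [MeasurableSpace X]
    [TopologicalSpace X] [PolishSpace X] [BorelSpace X] {μ : Measure X} [IsFiniteMeasure μ]
    {A : StarSubalgebra ℝ (BoundedContinuousFunction X ℝ)}
    (hA : (A.map (BoundedContinuousFunction.toContinuousMapStarₐ ℝ)).SeparatesPoints)
    {h : X → ℝ} (hint : Integrable h μ) (h0 : ∀ a ∈ A, ∫ x, h x * a x ∂μ = 0) :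
    ∀ᵐ x ∂μ, h x = 0 := by
  have hm : AEMeasurable h μ := hint.1.aemeasurable
  have hintn : Integrable (fun x => -h x) μ := hint.neg
  have hfin : ∀ g : X → ℝ, Integrable g μ →
      IsFiniteMeasure (μ.withDensity fun x => ENNReal.ofReal (g x)) := fun g hg =>
    isFiniteMeasure_withDensity_ofReal hg.2
  have := hfin h hint
  have := hfin (fun x => -h x) hintn
  have hbd : ∀ (g : X → ℝ), Integrable g μ → ∀ a : BoundedContinuousFunction X ℝ,
      Integrable (fun x => g x * a x) μ := fun g hg a =>
    hg.mul_bdd (c := ‖a‖) a.continuous.aestronglyMeasurable (ae_of_all _ a.norm_coe_le_norm)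
  have hwd : ∀ (g : X → ℝ), Integrable g μ → ∀ a : BoundedContinuousFunction X ℝ,
      ∫ x, a x ∂(μ.withDensity fun x => ENNReal.ofReal (g x)) = ∫ x, max (g x) 0 * a x ∂μ := by
    intro g hg a
    rw [integral_withDensity_eq_integral_toReal_smul₀ hg.1.aemeasurable.ennreal_ofReal
      (ae_of_all _ fun x => ENNReal.ofReal_lt_top)]
    simp [ENNReal.toReal_ofReal']
  have heq : (μ.withDensity fun x => ENNReal.ofReal (h x)) =
      μ.withDensity fun x => ENNReal.ofReal (-h x) := by
    refine ext_of_forall_mem_subalgebra_integral_eq_of_polish hA fun a ha => ?_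
    rw [hwd h hint a, hwd _ hintn a, ← sub_eq_zero,
      ← integral_sub (hbd _ hint.pos_part a) (hbd _ hintn.pos_part a)]
    refine Eq.trans ?_ (h0 a ha)
    refine integral_congr_ae (ae_of_all _ fun x => ?_)
    dsimp only
    rw [← sub_mul, max_zero_sub_max_neg_zero_eq_self]
  rw [withDensity_eq_iff hm.ennreal_ofReal hintn.1.aemeasurable.ennreal_ofReal hint.lintegral_lt_top.ne] at heq
  filter_upwards [heq] with x hx
  rcases le_total 0 (h x) with hx0 | hx0
  · rw [ENNReal.ofReal_of_nonpos (neg_nonpos.2 hx0), ENNReal.ofReal_eq_zero] at hx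
    exact le_antisymm hx hx0
  · rw [ENNReal.ofReal_of_nonpos hx0, eq_comm, ENNReal.ofReal_eq_zero] at hx
    linarith

section

variable {d : ℕ}

instance (s t : ℝ) : IsFiniteMeasure (spaceTime d s t) := by
  unfold spaceTime
  infer_instance

theorem spaceTime_eq_restrict {s t s' t' : ℝ} (hs : s' ≤ s) (ht : t ≤ t') :
    spaceTime d s t = (spaceTime d s' t').restrict (Ioo s t ×ˢ univ) := by
  unfold spaceTime
  rw [← Measure.prod_restrict, Measure.restrict_univ, Measure.restrict_restrict measurableSet_Ioo,
    inter_eq_left.2 (Ioo_subset_Ioo hs ht)]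

theorem ae_fst_mem_spaceTime (s t : ℝ) : ∀ᵐ p ∂spaceTime d s t, p.1 ∈ Ioo s t := by
  rw [spaceTime_eq_restrict le_rfl le_rfl]
  filter_upwards [ae_restrict_mem (measurableSet_Ioo.prod MeasurableSet.univ)] with p hp
  exact hp.1

/-- The algebra of bounded smooth functions on `ℝ × Ω`. -/
noncomputable def smoothAlgebra (d : ℕ) :
    StarSubalgebra ℝ (BoundedContinuousFunction (ℝ × Torus d) ℝ) where
  carrier := {a | SmoothField fun t x => a (t, x)}
  mul_mem' {a b} ha hb := by
    have : ContDiff ℝ ∞ _ := ContDiff.mul ha hb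
    exact this
  add_mem' {a b} ha hb := by
    have : ContDiff ℝ ∞ _ := ContDiff.add ha hb
    exact this
  algebraMap_mem' c := by
    have : ContDiff ℝ ∞ fun _ : ℝ × (Fin d → ℝ) => c := contDiff_const
    exact this
  star_mem' {a} ha := by
    have : star a = a := by ext; simp
    rw [this]
    exact ha

/-- Times are separated by arctan, which is bounded; points of the torus by the real or imaginary
part of exp(2πi x_k). -/
theorem exists_smooth_of_ne {p q : ℝ × Torus d} (hpq : p ≠ q) :
    ∃ f : ℝ → Torus d → ℝ, SmoothField f ∧ (∃ C, ∀ t x, ‖f t x‖ ≤ C) ∧ f p.1 p.2 ≠ f q.1 q.2 := by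
  by_cases h1 : p.1 = q.1
  · have h2 : p.2 ≠ q.2 := fun h => hpq (Prod.ext h1 h)
    obtain ⟨k, hk⟩ := Function.ne_iff.1 h2
    have h3 : (AddCircle.toCircle (p.2 k) : ℂ) ≠ AddCircle.toCircle (q.2 k) := fun h =>
      hk (AddCircle.injective_toCircle one_ne_zero (Subtype.ext h))
    have hsm : ContDiff ℝ ∞ fun y : ℝ × (Fin d → ℝ) =>
        ((AddCircle.toCircle (toTorus y.2 k) : Circle) : ℂ) := by
      have : (fun y : ℝ × (Fin d → ℝ) => ((AddCircle.toCircle (toTorus y.2 k) : Circle) : ℂ)) =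
          fun y => Complex.exp (Complex.ofRealCLM (2 * Real.pi / 1 * y.2 k) * Complex.I) := by
        ext y
        simp [toTorus, AddCircle.toCircle_apply_mk, Circle.coe_exp]
      rw [this]
      refine Complex.contDiff_exp.comp (ContDiff.mul (Complex.ofRealCLM.contDiff.comp ?_)
        contDiff_const)
      fun_prop
    by_cases hre : (AddCircle.toCircle (p.2 k) : ℂ).re = (AddCircle.toCircle (q.2 k) : ℂ).re
    · refine ⟨fun _ x => (AddCircle.toCircle (x k) : ℂ).im, Complex.imCLM.contDiff.comp hsm,
        ⟨1, fun t x => ?_⟩, fun him => h3 (Complex.ext hre him)⟩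
      exact (Complex.abs_im_le_norm _).trans (Circle.norm_coe _).le
    · refine ⟨fun _ x => (AddCircle.toCircle (x k) : ℂ).re, Complex.reCLM.contDiff.comp hsm,
        ⟨1, fun t x => ?_⟩, hre⟩
      exact (Complex.abs_re_le_norm _).trans (Circle.norm_coe _).le
  · refine ⟨fun t _ => Real.arctan t, Real.contDiff_arctan.comp contDiff_fst,
      ⟨Real.pi / 2, fun t x => ?_⟩, fun h => h1 (Real.arctan_injective h)⟩
    exact abs_le.2 ⟨(Real.neg_pi_div_two_lt_arctan t).le, (Real.arctan_lt_pi_div_two t).le⟩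

theorem smoothAlgebra_separatesPoints : ((smoothAlgebra d).map
    (BoundedContinuousFunction.toContinuousMapStarₐ ℝ)).SeparatesPoints := by
  intro p q hpq
  obtain ⟨f, hf, ⟨C, hC⟩, hne⟩ := exists_smooth_of_ne hpq
  exact ⟨_, ⟨_, ⟨BoundedContinuousFunction.ofNormedAddCommGroup (fun p : ℝ × Torus d => f p.1 p.2)
    hf.continuous C fun p => hC p.1 p.2, hf, rfl⟩, rfl⟩, hne⟩

/-- A bump function in time. -/
noncomputable def timeBump (s t r : ℝ) : ℝ := expNegInvGlue (r - s) * expNegInvGlue (t - r)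

theorem contDiff_timeBump (s t : ℝ) : ContDiff ℝ ∞ (timeBump s t) :=
  (expNegInvGlue.contDiff.comp (contDiff_id.sub contDiff_const)).mul
    (expNegInvGlue.contDiff.comp (contDiff_const.sub contDiff_id))

theorem timeBump_pos {s t r : ℝ} (h : r ∈ Ioo s t) : 0 < timeBump s t r :=
  mul_pos (expNegInvGlue.pos_of_pos (by linarith [h.1]))
    (expNegInvGlue.pos_of_pos (by linarith [h.2]))

theorem timeBump_eq_zero {s t r : ℝ} (h : r ∉ Ioo s t) : timeBump s t r = 0 := by
  rw [mem_Ioo, not_and_or, not_lt, not_lt] at h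
  rcases h with h | h
  · simp [timeBump, expNegInvGlue.zero_of_nonpos (sub_nonpos.2 h)]
  · simp [timeBump, expNegInvGlue.zero_of_nonpos (sub_nonpos.2 h)]

theorem timeBump_le_one (s t r : ℝ) : ‖timeBump s t r‖ ≤ 1 := by
  have h : ∀ x, 0 ≤ expNegInvGlue x ∧ expNegInvGlue x ≤ 1 := fun x =>
    ⟨expNegInvGlue.nonneg x, by
      unfold expNegInvGlue
      split_ifs with hx
      · exact zero_le_one
      · exact Real.exp_le_one_iff.2 (neg_nonpos.2 (inv_nonneg.2 (not_le.1 hx).le))⟩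
  rw [timeBump, norm_mul, Real.norm_of_nonneg (h _).1, Real.norm_of_nonneg (h _).1]
  exact mul_le_one₀ (h _).2 (h _).1 (h _).2

/-- Multiplication by a bounded function of compact support in time turns local integrability
into integrability. -/
theorem integrable_smul_of_local {V : Type*} [NormedAddCommGroup V] [NormedSpace ℝ V] {T s t : ℝ}
    (hs : 0 ≤ s) (ht : t ≤ T) {h : ℝ × Torus d → V} (hh : Integrable h (spaceTime d s t))
    {a : ℝ × Torus d → ℝ} (ha : AEStronglyMeasurable a (spaceTime d 0 T)) {C : ℝ}
    (hC : ∀ᵐ p ∂spaceTime d 0 T, ‖a p‖ ≤ C)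
    (h0 : ∀ p : ℝ × Torus d, p.1 ∉ Ioo s t → a p = 0) :
    Integrable (fun p => a p • h p) (spaceTime d 0 T) := by
  have hset : MeasurableSet (Ioo s t ×ˢ (univ : Set (Torus d))) :=
    measurableSet_Ioo.prod MeasurableSet.univ
  rw [spaceTime_eq_restrict hs ht] at hh
  have h1 : IntegrableOn (fun p => a p • h p) (Ioo s t ×ˢ univ) (spaceTime d 0 T) :=
    Integrable.bdd_smul (C := C) hh ha.restrict (ae_restrict_of_ae hC)
  refine (integrable_indicator_iff hset).2 h1 |>.congr (ae_of_all _ fun p => ?_)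
  by_cases hp : p ∈ Ioo s t ×ˢ (univ : Set (Torus d))
  · simp [indicator_of_mem hp]
  · rw [indicator_of_notMem hp]
    have : p.1 ∉ Ioo s t := fun h' => hp ⟨h', mem_univ _⟩
    simp [h0 p this]

/-- A time bump does two things at once: it makes h globally integrable, and it turns any bounded
smooth function into a test function supported in [s, t]. The intervals (1/(j+1), T - 1/(j+1)) then
exhaust (0, T). -/
theorem ae_eq_zero_of_forall_test {T : ℝ} {h : ℝ × Torus d → ℝ}
    (hloc : ∀ s t, 0 < s → t < T → Integrable h (spaceTime d s t))
    (htest : ∀ φ : ℝ → Torus d → ℝ, SmoothField φ →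
      (∃ s t, 0 < s ∧ t < T ∧ ∀ r, r ∉ Icc s t → ∀ x, φ r x = 0) →
        ∫ p, h p * φ p.1 p.2 ∂spaceTime d 0 T = 0) :
    ∀ᵐ p ∂spaceTime d 0 T, h p = 0 := by
  have key : ∀ s t, 0 < s → t < T → ∀ᵐ p ∂spaceTime d 0 T, p.1 ∈ Ioo s t → h p = 0 := by
    intro s t hs ht
    have hint : Integrable (fun p : ℝ × Torus d => timeBump s t p.1 • h p) (spaceTime d 0 T) :=
      integrable_smul_of_local hs.le ht.le (hloc s t hs ht)
        ((contDiff_timeBump s t).continuous.comp continuous_fst).aestronglyMeasurable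
        (ae_of_all _ fun p => timeBump_le_one s t p.1) fun p hp => timeBump_eq_zero hp
    have hz : ∀ a ∈ smoothAlgebra d,
        ∫ p, timeBump s t p.1 • h p * a p ∂spaceTime d 0 T = 0 := fun a ha => ?_
    · filter_upwards [ae_eq_zero_of_forall_integral_mul_eq_zero smoothAlgebra_separatesPoints
        hint hz] with p hp hpt
      exact (mul_eq_zero.1 hp).resolve_left (timeBump_pos hpt).ne'
    · have ha' : SmoothField fun t x => a (t, x) := ha
      have ha'' := ha'.smul (contDiff_timeBump s t)
      refine Eq.trans ?_ (htest (fun r x => timeBump s t r • a (r, x)) ha''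
        ⟨s, t, hs, ht, fun r hr x => by
          rw [timeBump_eq_zero fun h' => hr (Ioo_subset_Icc_self h'), zero_smul]⟩)
      refine integral_congr_ae (ae_of_all _ fun p => ?_)
      simp only [smul_eq_mul]
      ring
  have hall : ∀ᵐ p ∂spaceTime d 0 T, ∀ j : ℕ,
      p.1 ∈ Ioo (1 / ((j : ℝ) + 1)) (T - 1 / ((j : ℝ) + 1)) → h p = 0 :=
    ae_all_iff.2 fun j => key _ _ (by positivity) (by
      have : (0 : ℝ) < 1 / ((j : ℝ) + 1) := by positivity
      linarith)
  filter_upwards [hall, ae_fst_mem_spaceTime (d := d) 0 T] with p hp hpt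
  obtain ⟨j, hj⟩ := exists_nat_one_div_lt (lt_min hpt.1 (sub_pos.2 hpt.2))
  rw [lt_min_iff] at hj
  exact hp j ⟨hj.1, by linarith [hj.2]⟩

end

/-! ### Weights -/

section Weights

theorem IsWeight.integrableOn {T : ℝ} {k : ℝ → ℝ} (hk : IsWeight T k) :
    IntegrableOn k (Icc 0 T) := by
  obtain ⟨hm, c, C, hc, h⟩ := hk
  have : IsFiniteMeasure (volume.restrict (Icc 0 T)) :=
    isFiniteMeasure_restrict.2 measure_Icc_lt_top.ne
  refine Integrable.of_bound hm C ?_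
  filter_upwards [ae_restrict_mem measurableSet_Icc] with t ht
  rw [Real.norm_of_nonneg (hc.le.trans (h t ht).1)]
  exact (h t ht).2

theorem IsWeight.intervalIntegrable {T : ℝ} {k : ℝ → ℝ} (hk : IsWeight T k) {s t : ℝ}
    (hs : s ∈ Icc 0 T) (ht : t ∈ Icc 0 T) : IntervalIntegrable k volume s t :=
  intervalIntegrable_iff.2 (hk.integrableOn.mono_set
    (uIoc_subset_uIcc.trans (uIcc_subset_Icc hs ht)))

/-- The tail weight degenerates only at T; before any T' < T it can be divided out. -/
theorem IsWeight.mul_le_tailWeight {T : ℝ} {k : ℝ → ℝ} (hk : IsWeight T k) :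
    ∃ c : ℝ, 0 < c ∧ ∀ t ∈ Icc 0 T, c * (T - t) ≤ tailWeight T k t := by
  obtain ⟨c, C, hc, h⟩ := hk.2
  refine ⟨c, hc, fun t ht => ?_⟩
  have hT : T ∈ Icc 0 T := ⟨ht.1.trans ht.2, le_rfl⟩
  have := intervalIntegral.integral_mono_on ht.2 (intervalIntegrable_const (c := c))
    (hk.intervalIntegrable ht hT) fun s hs => (h s ⟨ht.1.trans hs.1, hs.2⟩).1
  simp only [intervalIntegral.integral_const, smul_eq_mul] at this
  unfold tailWeight
  linarith

theorem IsWeight.tailWeight_eq {T : ℝ} {k : ℝ → ℝ} (hk : IsWeight T k) {t : ℝ}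
    (ht : t ∈ Icc 0 T) :
    tailWeight T k t = (∫ s in (0 : ℝ)..T, k s) - ∫ s in (0 : ℝ)..t, (Icc 0 T).indicator k s := by
  have hT : T ∈ Icc 0 T := ⟨ht.1.trans ht.2, le_rfl⟩
  have h0 : (0 : ℝ) ∈ Icc 0 T := ⟨le_rfl, ht.1.trans ht.2⟩
  have h1 : ∫ s in (0 : ℝ)..t, (Icc 0 T).indicator k s = ∫ s in (0 : ℝ)..t, k s :=
    intervalIntegral.integral_congr fun s hs =>
      indicator_of_mem (uIcc_subset_Icc h0 ht hs) k
  rw [h1, ← intervalIntegral.integral_add_adjacent_intervals (hk.intervalIntegrable h0 ht)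
    (hk.intervalIntegrable ht hT), tailWeight]
  ring

theorem IsWeight.exists_continuous_tailWeight {T : ℝ} {k : ℝ → ℝ} (hk : IsWeight T k) :
    ∃ κ : ℝ → ℝ, Continuous κ ∧ ∀ t ∈ Icc 0 T, tailWeight T k t = κ t := by
  have hint : Integrable ((Icc 0 T).indicator k) :=
    (integrable_indicator_iff measurableSet_Icc).2 hk.integrableOn
  refine ⟨fun t => (∫ s in (0 : ℝ)..T, k s) - ∫ s in (0 : ℝ)..t, (Icc 0 T).indicator k s,
    continuous_const.sub
      (intervalIntegral.continuous_primitive (fun _ _ => hint.intervalIntegrable) 0),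
    fun t ht => hk.tailWeight_eq ht⟩

/-- Smooth approximation of a weight and of its tail integral. -/
theorem IsWeight.exists_smooth_approx {T : ℝ} {k : ℝ → ℝ} (hk : IsWeight T k) :
    ∃ κ k' : ℕ → ℝ → ℝ, (∀ j, ContDiff ℝ ∞ (κ j)) ∧ (∀ j, Continuous (k' j)) ∧
      (∀ j t, HasDerivAt (κ j) (-k' j t) t) ∧
      (∃ C, ∀ j, ∀ t ∈ Icc 0 T, |κ j t| ≤ C ∧ |k' j t| ≤ C) ∧
      (∀ t ∈ Icc 0 T, Tendsto (fun j => κ j t) atTop (𝓝 (tailWeight T k t))) ∧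
      ∀ᵐ t ∂volume.restrict (Ioo 0 T), Tendsto (fun j => k' j t) atTop (𝓝 (k t)) := by
  obtain ⟨hm, c, C, hc, h⟩ := id hk
  set K : ℝ → ℝ := (Icc 0 T).indicator k with hK
  have hint : Integrable K := (integrable_indicator_iff measurableSet_Icc).2 hk.integrableOn
  have hKC : ∀ t, ‖K t‖ ≤ |C| := fun t => by
    by_cases ht : t ∈ Icc 0 T
    · rw [hK, indicator_of_mem ht, Real.norm_of_nonneg (hc.le.trans (h t ht).1)]
      exact (h t ht).2.trans (le_abs_self C)
    · rw [hK, indicator_of_notMem ht, norm_zero]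
      exact abs_nonneg C
  -- The outer radius is twice the inner one; a bounded ratio is what a.e. convergence of the
  -- mollifications requires.
  let φ : ℕ → ContDiffBump (0 : ℝ) := fun j =>
    ⟨1 / ((j : ℝ) + 1), 2 * (1 / ((j : ℝ) + 1)), by positivity, by
      have : (0 : ℝ) < 1 / ((j : ℝ) + 1) := by positivity
      linarith⟩
  have hφ : Tendsto (fun j => (φ j).rOut) atTop (𝓝 0) := by
    have := (tendsto_one_div_add_atTop_nhds_zero_nat (𝕜 := ℝ)).const_mul 2
    rwa [mul_zero] at this
  let k' : ℕ → ℝ → ℝ := fun j => convolution ((φ j).normed volume) K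
    (ContinuousLinearMap.lsmul ℝ ℝ) volume
  have hk's : ∀ j, ContDiff ℝ ∞ (k' j) := fun j =>
    (φ j).hasCompactSupport_normed.contDiff_convolution_left _ (φ j).contDiff_normed
      hint.locallyIntegrable
  have hk'C : ∀ j t, ‖k' j t‖ ≤ |C| := fun j t => by
    have h1 : Integrable fun s => (φ j).normed volume s * |C| := (φ j).integrable_normed.mul_const _
    have h2 := norm_integral_le_of_norm_le (μ := volume)
      (f := fun s => (φ j).normed volume s • K (t - s)) h1 (ae_of_all _ fun s => by
        rw [norm_smul, Real.norm_of_nonneg ((φ j).nonneg_normed s)]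
        exact mul_le_mul_of_nonneg_left (hKC _) ((φ j).nonneg_normed s))
    rw [integral_mul_const, (φ j).integral_normed, one_mul] at h2
    exact h2
  have hk't : ∀ᵐ t : ℝ, Tendsto (fun j => k' j t) atTop (𝓝 (K t)) :=
    ContDiffBump.ae_convolution_tendsto_right_of_locallyIntegrable (K := 2) hφ
      (Eventually.of_forall fun j => le_rfl) hint.locallyIntegrable
  set c₀ := ∫ s in (0 : ℝ)..T, k s with hc₀
  -- The approximation starts from the exact value ∫₀ᵀ k at t = 0; its derivative is -k'_j and only
  -- primitives from 0 have to converge.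
  let κ : ℕ → ℝ → ℝ := fun j t => c₀ - ∫ s in (0 : ℝ)..t, k' j s
  have hκd : ∀ j t, HasDerivAt (κ j) (-k' j t) t := fun j t => by
    have := (hk's j).continuous.integral_hasStrictDerivAt 0 t
    simpa using this.hasDerivAt.const_sub c₀
  refine ⟨κ, k', fun j => ?_, fun j => (hk's j).continuous, hκd,
    ⟨|c₀| + |C| * |T| + |C|, fun j t ht => ⟨?_, ?_⟩⟩, fun t ht => ?_, ?_⟩
  · rw [contDiff_infty_iff_deriv]
    refine ⟨fun t => (hκd j t).differentiableAt, ?_⟩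
    rw [show deriv (κ j) = fun t => -k' j t from funext fun t => (hκd j t).deriv]
    exact (hk's j).neg
  · have h1 := intervalIntegral.norm_integral_le_of_norm_le_const (a := 0) (b := t)
      fun s _ => hk'C j s
    rw [sub_zero] at h1
    have h2 : |C| * |t| ≤ |C| * |T| :=
      mul_le_mul_of_nonneg_left (abs_le_abs_of_nonneg ht.1 ht.2) (abs_nonneg _)
    have h3 := abs_sub c₀ (∫ s in (0 : ℝ)..t, k' j s)
    rw [Real.norm_eq_abs] at h1
    have := abs_nonneg C
    exact h3.trans (by linarith)
  · have := hk'C j t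
    rw [Real.norm_eq_abs] at this
    have : 0 ≤ |c₀| + |C| * |T| := by positivity
    linarith
  · rw [hk.tailWeight_eq ht]
    refine tendsto_const_nhds.sub ?_
    exact intervalIntegral.tendsto_integral_filter_of_dominated_convergence (fun _ => |C|)
      (Eventually.of_forall fun j => (hk's j).continuous.aestronglyMeasurable)
      (Eventually.of_forall fun j => ae_of_all _ fun s _ => hk'C j s)
      intervalIntegrable_const (hk't.mono fun s hs _ => hs)
  · filter_upwards [ae_restrict_of_ae hk't, ae_restrict_mem measurableSet_Ioo] with t h1 h2
    rwa [hK, indicator_of_mem (Ioo_subset_Icc_self h2)] at h1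

end Weights

/-! ### Locally integrable fields and test fields -/

section Local

variable {d n N : ℕ}

theorem aestronglyMeasurable_fst {T : ℝ} {a : ℝ → ℝ}
    (ha : AEStronglyMeasurable a (volume.restrict (Ioo 0 T))) :
    AEStronglyMeasurable (fun p : ℝ × Torus d => a p.1) (spaceTime d 0 T) :=
  ha.comp_fst

/-- Truncation to the slightly larger interval (s/2, (t + T)/2), which contains the closed support
[s, t], replaces a locally integrable field by an integrable one under integrals against test
fields. -/
theorem exists_integrable_eq_of_local {V : Type*} [NormedAddCommGroup V] [NormedSpace ℝ V]
    {T s t : ℝ} {f : ℝ × Torus d → V}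
    (hf : ∀ s t, 0 < s → t < T → Integrable f (spaceTime d s t)) (hs : 0 < s) (ht : t < T) :
    ∃ f' : ℝ × Torus d → V, Integrable f' (spaceTime d 0 T) ∧
      ∀ p : ℝ × Torus d, p.1 ∈ Icc s t → f' p = f p := by
  classical
  refine ⟨fun p => (Ioo (s / 2) ((t + T) / 2)).indicator (fun _ => (1 : ℝ)) p.1 • f p,
    integrable_smul_of_local (C := 1) (by positivity) (by linarith)
      (hf (s / 2) ((t + T) / 2) (by positivity) (by linarith))
      ((measurable_const.indicator measurableSet_Ioo).comp measurable_fst).aestronglyMeasurable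
      (ae_of_all _ fun p => ?_) fun p hp => indicator_of_notMem hp _, fun p hp => ?_⟩
  · rw [indicator_apply]
    split_ifs <;> simp
  · have : p.1 ∈ Ioo (s / 2) ((t + T) / 2) := ⟨by linarith [hp.1], by linarith [hp.2]⟩
    simp [indicator_of_mem this]

theorem integrable_inner_of_local {T s t C : ℝ} {f w : ℝ × Torus d → E n}
    (hf : ∀ s t, 0 < s → t < T → Integrable f (spaceTime d s t)) (hs : 0 < s) (ht : t < T)
    (hw : AEStronglyMeasurable w (spaceTime d 0 T)) (hC : ∀ᵐ p ∂spaceTime d 0 T, ‖w p‖ ≤ C)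
    (h0 : ∀ p : ℝ × Torus d, p.1 ∉ Icc s t → w p = 0) :
    Integrable (fun p => inner ℝ (f p) (w p)) (spaceTime d 0 T) := by
  obtain ⟨f', hf', hff'⟩ := exists_integrable_eq_of_local hf hs ht
  have he : (fun p => inner ℝ (f p) (w p)) = fun p => inner ℝ (f' p) (w p) := by
    ext p
    by_cases hp : p.1 ∈ Icc s t
    · rw [hff' p hp]
    · rw [h0 p hp, inner_zero_right, inner_zero_right]
  rw [he]
  refine Integrable.mono' (hf'.norm.mul_const C) (hf'.1.inner hw) ?_
  filter_upwards [hC] with p hp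
  exact (norm_inner_le_norm _ _).trans (mul_le_mul_of_nonneg_left hp (norm_nonneg _))

theorem tendsto_integral_inner_of_local {T s t C : ℝ} {f w : ℝ × Torus d → E n}
    {w' : ℕ → ℝ × Torus d → E n}
    (hf : ∀ s t, 0 < s → t < T → Integrable f (spaceTime d s t)) (hs : 0 < s) (ht : t < T)
    (hw : ∀ j, AEStronglyMeasurable (w' j) (spaceTime d 0 T))
    (hC : ∀ j, ∀ᵐ p ∂spaceTime d 0 T, ‖w' j p‖ ≤ C)
    (h0 : ∀ j, ∀ p : ℝ × Torus d, p.1 ∉ Icc s t → w' j p = 0)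
    (hlim : ∀ᵐ p ∂spaceTime d 0 T, Tendsto (fun j => w' j p) atTop (𝓝 (w p))) :
    Tendsto (fun j => ∫ p, inner ℝ (f p) (w' j p) ∂spaceTime d 0 T) atTop
      (𝓝 (∫ p, inner ℝ (f p) (w p) ∂spaceTime d 0 T)) := by
  obtain ⟨f', hf', hff'⟩ := exists_integrable_eq_of_local hf hs ht
  have he : ∀ j, (fun p => inner ℝ (f p) (w' j p)) = fun p => inner ℝ (f' p) (w' j p) := fun j => by
    ext p
    by_cases hp : p.1 ∈ Icc s t
    · rw [hff' p hp]
    · rw [h0 j p hp, inner_zero_right, inner_zero_right]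
  refine tendsto_integral_of_dominated_convergence (fun p => ‖f' p‖ * C) (fun j => ?_)
    (hf'.norm.mul_const C) (fun j => ?_) ?_
  · rw [he j]
    exact hf'.1.inner (hw j)
  · filter_upwards [hC j] with p hp
    rw [congrFun (he j) p]
    exact (norm_inner_le_norm _ _).trans (mul_le_mul_of_nonneg_left hp (norm_nonneg _))
  · filter_upwards [hlim] with p hp
    exact tendsto_const_nhds.inner hp

theorem deriv_eq_zero_of_support {V : Type*} [NormedAddCommGroup V] [NormedSpace ℝ V]
    {ψ : ℝ → Torus d → V} {s t : ℝ} (h : ∀ r, r ∉ Icc s t → ∀ x, ψ r x = 0) {r : ℝ}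
    (hr : r ∉ Icc s t) (x : Torus d) : deriv (fun r => ψ r x) r = 0 := by
  have : (fun r => ψ r x) =ᶠ[𝓝 r] fun _ => 0 := by
    filter_upwards [isClosed_Icc.isOpen_compl.mem_nhds hr] with r' hr'
    exact h r' hr' x
  rw [this.deriv_eq, deriv_const]

theorem ae_eq_zero_of_forall_vector_test {T : ℝ} {h : ℝ × Torus d → E n}
    (hloc : ∀ s t, 0 < s → t < T → Integrable h (spaceTime d s t))
    (htest : ∀ ψ : ℝ → Torus d → E n, SmoothVecField ψ →
      (∃ s t, 0 < s ∧ t < T ∧ ∀ r, r ∉ Icc s t → ∀ x, ψ r x = 0) →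
        ∫ p, inner ℝ (h p) (ψ p.1 p.2) ∂spaceTime d 0 T = 0) :
    ∀ᵐ p ∂spaceTime d 0 T, h p = 0 := by
  have : ∀ᵐ p ∂spaceTime d 0 T, ∀ i, h p i = 0 := by
    refine ae_all_iff.2 fun i => ae_eq_zero_of_forall_test (fun s t hs ht => ?_)
      fun φ hφ hsupp => ?_
    · exact (EuclideanSpace.proj (𝕜 := ℝ) i).integrable_comp (hloc s t hs ht)
    · obtain ⟨s, t, hs, ht, h0⟩ := hsupp
      have hsm : SmoothVecField fun t x => EuclideanSpace.single i (φ t x) := by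
        unfold SmoothVecField
        rw [contDiff_euclidean]
        intro i'
        simp only [PiLp.single_apply]
        split_ifs
        · exact hφ
        · exact contDiff_const
      refine Eq.trans ?_ (htest _ hsm ⟨s, t, hs, ht, fun r hr x => by simp [h0 r hr x]⟩)
      refine integral_congr_ae (ae_of_all _ fun p => ?_)
      simp [EuclideanSpace.inner_single_right, mul_comm]
  filter_upwards [this] with p hp
  ext i
  exact hp i

/-- The product rule: if `D = ∂_t f` and `g = ∂_t (κ f)`, then `g = κ D - k f`. -/
theorem weakTimeDeriv_tailWeight {T : ℝ} {k : ℝ → ℝ} (hk : IsWeight T k)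
    {f D g : ℝ × Torus d → E n} (hD : HasWeakTimeDeriv T f D)
    (hg : HasWeakTimeDeriv T (fun p => tailWeight T k p.1 • f p) g) :
    ∀ᵐ p ∂spaceTime d 0 T, g p = tailWeight T k p.1 • D p - k p.1 • f p := by
  obtain ⟨κ', k', hκs, hk'c, hκd, ⟨C, hC⟩, hκlim, hklim⟩ := hk.exists_smooth_approx
  have hfloc := fun s t hs ht => (hD.1 s t hs ht).1
  have hDloc := fun s t hs ht => (hD.1 s t hs ht).2
  have hgloc := fun s t hs ht => (hg.1 s t hs ht).2
  obtain ⟨κ, hκc, hκ⟩ := hk.exists_continuous_tailWeight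
  have hκm : AEStronglyMeasurable (fun p : ℝ × Torus d => tailWeight T k p.1)
      (spaceTime d 0 T) := by
    refine (hκc.comp continuous_fst).aestronglyMeasurable.congr ?_
    filter_upwards [ae_fst_mem_spaceTime (d := d) 0 T] with p hp
    exact (hκ _ (Ioo_subset_Icc_self hp)).symm
  have hkm : AEStronglyMeasurable (fun p : ℝ × Torus d => k p.1) (spaceTime d 0 T) :=
    aestronglyMeasurable_fst (hk.1.mono_measure (Measure.restrict_mono_set _ Ioo_subset_Icc_self))
  have hκb : ∀ t ∈ Icc 0 T, |tailWeight T k t| ≤ C := fun t ht =>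
    le_of_tendsto (hκlim t ht).abs (Eventually.of_forall fun j => (hC j t ht).1)
  obtain ⟨c₁, C₁, hc₁, hC₁⟩ := hk.2
  have hkb : ∀ t ∈ Icc 0 T, |k t| ≤ C₁ := fun t ht => by
    rw [abs_of_nonneg (hc₁.le.trans (hC₁ t ht).1)]
    exact (hC₁ t ht).2
  have hklim' : ∀ᵐ p ∂spaceTime d 0 T, Tendsto (fun j => k' j p.1) atTop (𝓝 (k p.1)) :=
    Measure.quasiMeasurePreserving_fst.ae hklim
  have hmem : ∀ᵐ p ∂spaceTime d 0 T, p.1 ∈ Icc 0 T := by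
    filter_upwards [ae_fst_mem_spaceTime (d := d) 0 T] with p hp
    exact Ioo_subset_Icc_self hp
  have hmono : ∀ {s t : ℝ}, 0 < s → t < T → spaceTime d s t ≤ spaceTime d 0 T :=
    fun hs ht => by
      rw [spaceTime_eq_restrict hs.le ht.le]
      exact Measure.restrict_le_self
  suffices h : ∀ᵐ p ∂spaceTime d 0 T, g p - (tailWeight T k p.1 • D p - k p.1 • f p) = 0 by
    filter_upwards [h] with p hp
    exact sub_eq_zero.1 hp
  refine ae_eq_zero_of_forall_vector_test (fun s t hs ht => ?_) fun ψ hψ ⟨s, t, hs, ht, h0⟩ => ?_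
  · have hac := (hmono hs ht).absolutelyContinuous
    refine (hgloc s t hs ht).sub (Integrable.sub ?_ ?_)
    · exact (hDloc s t hs ht).bdd_smul C (hκm.mono_ac hac)
        (hac.ae_le (hmem.mono fun p hp => hκb _ hp))
    · exact (hfloc s t hs ht).bdd_smul C₁ (hkm.mono_ac hac)
        (hac.ae_le (hmem.mono fun p hp => hkb _ hp))
  · have hψ' : SmoothField ψ := hψ
    obtain ⟨A, hA⟩ := hψ'.exists_bound 0 T
    obtain ⟨B, hB⟩ := hψ'.deriv.exists_bound 0 T
    have hψc : AEStronglyMeasurable (fun p : ℝ × Torus d => ψ p.1 p.2) (spaceTime d 0 T) :=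
      hψ'.continuous.aestronglyMeasurable
    have hψdc : AEStronglyMeasurable (fun p : ℝ × Torus d => deriv (fun r => ψ r p.2) p.1)
      (spaceTime d 0 T) := hψ'.deriv.continuous.aestronglyMeasurable
    have hd0 := fun r (hr : r ∉ Icc s t) x => deriv_eq_zero_of_support h0 hr x
    have hb1 : ∀ (a : ℝ → ℝ) {M : ℝ}, (∀ t ∈ Icc 0 T, |a t| ≤ M) →
        ∀ᵐ p ∂spaceTime d 0 T, ‖a p.1 • ψ p.1 p.2‖ ≤ M * A := fun a M ha => by
      filter_upwards [hmem] with p hp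
      rw [norm_smul]
      exact mul_le_mul (ha _ hp) (hA _ hp _) (norm_nonneg _) ((abs_nonneg _).trans (ha _ hp))
    have hb2 : ∀ (a : ℝ → ℝ) {M : ℝ}, (∀ t ∈ Icc 0 T, |a t| ≤ M) →
        ∀ᵐ p ∂spaceTime d 0 T, ‖a p.1 • deriv (fun r => ψ r p.2) p.1‖ ≤ M * B := fun a M ha => by
      filter_upwards [hmem] with p hp
      rw [norm_smul]
      exact mul_le_mul (ha _ hp) (hB _ hp _) (norm_nonneg _) ((abs_nonneg _).trans (ha _ hp))
    have hz1 : ∀ (a : ℝ → ℝ) (p : ℝ × Torus d), p.1 ∉ Icc s t → a p.1 • ψ p.1 p.2 = 0 :=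
      fun a p hp => by rw [h0 _ hp, smul_zero]
    have hz2 : ∀ (a : ℝ → ℝ) (p : ℝ × Torus d), p.1 ∉ Icc s t →
        a p.1 • deriv (fun r => ψ r p.2) p.1 = 0 :=
      fun a p hp => by rw [hd0 _ hp, smul_zero]
    -- The field κψ need not be smooth, so ∂_t f = D is tested with κ'_j ψ, and both sides pass to
    -- the limit by dominated convergence.
    have hleft : Tendsto (fun j => ∫ p, inner ℝ (f p)
        (κ' j p.1 • deriv (fun r => ψ r p.2) p.1 - k' j p.1 • ψ p.1 p.2) ∂spaceTime d 0 T) atTop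
        (𝓝 (∫ p, inner ℝ (f p) (tailWeight T k p.1 • deriv (fun r => ψ r p.2) p.1 -
          k p.1 • ψ p.1 p.2) ∂spaceTime d 0 T)) := by
      refine tendsto_integral_inner_of_local (C := C * B + C * A) hfloc hs ht (fun j => ?_)
        (fun j => ?_) (fun j p hp => ?_) ?_
      · exact (((hκs j).continuous.comp continuous_fst).aestronglyMeasurable.smul hψdc).sub
          (((hk'c j).comp continuous_fst).aestronglyMeasurable.smul hψc)
      · filter_upwards [hb1 (k' j) fun t ht => (hC j t ht).2,
          hb2 (κ' j) fun t ht => (hC j t ht).1] with p h1 h2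
        exact (norm_sub_le _ _).trans (add_le_add h2 h1)
      · rw [hz1 _ p hp, hz2 _ p hp, sub_zero]
      · filter_upwards [hmem, hklim'] with p hp hp'
        exact ((hκlim _ hp).smul_const _).sub (hp'.smul_const _)
    have hright : Tendsto (fun j => ∫ p, inner ℝ (D p) (κ' j p.1 • ψ p.1 p.2) ∂spaceTime d 0 T)
        atTop (𝓝 (∫ p, inner ℝ (D p) (tailWeight T k p.1 • ψ p.1 p.2) ∂spaceTime d 0 T)) := by
      refine tendsto_integral_inner_of_local (C := C * A) hDloc hs ht (fun j => ?_)
        (fun j => hb1 (κ' j) fun t ht => (hC j t ht).1) (fun j p hp => hz1 _ p hp) ?_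
      · exact ((hκs j).continuous.comp continuous_fst).aestronglyMeasurable.smul hψc
      · filter_upwards [hmem] with p hp
        exact (hκlim _ hp).smul_const _
    have hj : ∀ j, ∫ p, inner ℝ (f p)
        (κ' j p.1 • deriv (fun r => ψ r p.2) p.1 - k' j p.1 • ψ p.1 p.2) ∂spaceTime d 0 T =
        -∫ p, inner ℝ (D p) (κ' j p.1 • ψ p.1 p.2) ∂spaceTime d 0 T := fun j => by
      rw [← hD.2 (fun r x => κ' j r • ψ r x) (hψ'.smul (hκs j))
        ⟨s, t, hs, ht, fun r hr x => by rw [h0 r hr, smul_zero]⟩]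
      refine integral_congr_ae (ae_of_all _ fun p => ?_)
      dsimp only
      rw [((hκd j p.1).fun_smul (hψ'.hasDerivAt p.1 p.2)).deriv, neg_smul, sub_eq_add_neg]
    simp only [hj] at hleft
    have hlim := tendsto_nhds_unique hleft hright.neg
    have hgψ := hg.2 ψ hψ ⟨s, t, hs, ht, h0⟩
    have I1 : Integrable (fun p => inner ℝ (g p) (ψ p.1 p.2)) (spaceTime d 0 T) :=
      integrable_inner_of_local (C := A) hgloc hs ht hψc
        (hmem.mono fun p hp => hA _ hp _) fun p hp => h0 _ hp _
    have I2 : Integrable (fun p => inner ℝ (D p) (tailWeight T k p.1 • ψ p.1 p.2))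
        (spaceTime d 0 T) :=
      integrable_inner_of_local hDloc hs ht (hκm.smul hψc) (hb1 _ hκb) fun p hp => hz1 _ p hp
    have I3 : Integrable (fun p => inner ℝ (f p) (k p.1 • ψ p.1 p.2)) (spaceTime d 0 T) :=
      integrable_inner_of_local hfloc hs ht (hkm.smul hψc) (hb1 _ hkb) fun p hp => hz1 _ p hp
    have I4 : Integrable (fun p => inner ℝ (f p)
        (tailWeight T k p.1 • deriv (fun r => ψ r p.2) p.1)) (spaceTime d 0 T) :=
      integrable_inner_of_local hfloc hs ht (hκm.smul hψdc) (hb2 _ hκb) fun p hp => hz2 _ p hp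
    have e1 : ∫ p, inner ℝ (g p - (tailWeight T k p.1 • D p - k p.1 • f p)) (ψ p.1 p.2)
        ∂spaceTime d 0 T = ∫ p, inner ℝ (g p) (ψ p.1 p.2) ∂spaceTime d 0 T -
        (∫ p, inner ℝ (D p) (tailWeight T k p.1 • ψ p.1 p.2) ∂spaceTime d 0 T -
          ∫ p, inner ℝ (f p) (k p.1 • ψ p.1 p.2) ∂spaceTime d 0 T) := by
      have I23 : Integrable (fun p => inner ℝ (D p) (tailWeight T k p.1 • ψ p.1 p.2) -
          inner ℝ (f p) (k p.1 • ψ p.1 p.2)) (spaceTime d 0 T) := I2.sub I3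
      rw [← integral_sub I2 I3, ← integral_sub I1 I23]
      refine integral_congr_ae (ae_of_all _ fun p => ?_)
      simp only [inner_sub_left, real_inner_smul_left, real_inner_smul_right]
    simp only [inner_sub_right] at hlim
    rw [integral_sub I4 I3] at hlim
    simp only [real_inner_smul_left] at hgψ
    simp only [real_inner_smul_right] at hlim e1
    rw [e1]
    linarith

/-- The values of `L*(f)` belong to `Λ`. -/
theorem HasWeakLstar.ae_mem_Lam {ν : ℕ} {b : Coeff d n N} {T : ℝ} {f : ℝ × Torus d → E n}
    {G : ℝ × Torus d → Mat N} (h : HasWeakLstar ν b T f G) :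
    ∀ᵐ p ∂spaceTime d 0 T, G p ∈ Lam ν b := by
  -- Λ is the common kernel of finitely many functionals, the coordinates of the quotient by Λ, so
  -- it suffices to treat one functional that vanishes on Λ.
  have key : ∀ ℓ : Mat N →ₗ[ℝ] ℝ, (∀ A ∈ Lam ν b, ℓ A = 0) →
      ∀ᵐ p ∂spaceTime d 0 T, ℓ (G p) = 0 := by
    intro ℓ hℓ
    set P : Mat N := Matrix.of fun l m => ℓ (Matrix.single l m 1) with hP
    have hfrob : ∀ A, ℓ A = frob A P := fun A => by
      conv_lhs => rw [Matrix.matrix_eq_sum_single A]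
      simp only [map_sum, frob, hP, Matrix.of_apply]
      refine Finset.sum_congr rfl fun l _ => Finset.sum_congr rfl fun m _ => ?_
      rw [← smul_eq_mul, ← map_smul, Matrix.smul_single, smul_eq_mul, mul_one]
    -- Test fields must be symmetric. Symmetrising P does not change its product with symmetric
    -- matrices, and Q is still orthogonal to Λ, so L(φQ) = 0.
    set Q : Mat N := (1 / 2 : ℝ) • (P + P.transpose) with hQ
    have hfQ : ∀ A : Mat N, A.IsSymm → frob A Q = frob A P := fun A hA => by
      rw [hQ, frob_smul_right, frob_add_right, frob_transpose_right, hA.eq]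
      ring
    have hQs : Q.IsSymm := by
      refine Matrix.IsSymm.smul ?_ _
      rw [Matrix.IsSymm, Matrix.transpose_add, Matrix.transpose_transpose, add_comm]
    have hQ0 : ∀ A ∈ Lam ν b, frob A Q = 0 := fun A hA => by
      rw [hfQ A (Lam_isSymm ν b hA), ← hfrob, hℓ A hA]
    have hz : ∀ᵐ p ∂spaceTime d 0 T, frob (G p) Q = 0 := by
      refine ae_eq_zero_of_forall_test (fun s t hs ht => ?_) fun φ hφ ⟨s, t, hs, ht, h0⟩ => ?_
      · unfold frob
        exact integrable_finsetSum _ fun l _ => integrable_finsetSum _ fun m _ =>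
          ((h.2.1 s t hs ht).2 l m).mul_const _
      · have hφt : ∀ t, ContDiff ℝ ∞ fun y : Fin d → ℝ => φ t (toTorus y) := fun t =>
          ContDiff.comp (g := fun p : ℝ × (Fin d → ℝ) => φ p.1 (toTorus p.2)) hφ
            (contDiff_const.prodMk contDiff_id)
        have := h.2.2 (fun t x => φ t x • Q)
          ⟨fun t x => hQs.smul _, fun l m => ContDiff.mul hφ contDiff_const⟩
          ⟨s, t, hs, ht, fun r hr x => by rw [h0 r hr x, zero_smul]⟩
        simp only [opL_smul_eq_zero ν b hQs hQ0 (hφt _), inner_zero_right, integral_zero,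
          frob_smul_right] at this
        simpa only [mul_comm] using this
    filter_upwards [hz, h.1] with p h1 h2
    rw [hfrob, ← hfQ _ h2, h1]
  let bs := Module.finBasis ℝ (Mat N ⧸ Lam ν b)
  have hall : ∀ᵐ p ∂spaceTime d 0 T, ∀ i, bs.coord i ((Lam ν b).mkQ (G p)) = 0 := by
    refine ae_all_iff.2 fun i => key ((bs.coord i).comp (Lam ν b).mkQ) fun A hA => ?_
    rw [LinearMap.comp_apply, (Submodule.Quotient.mk_eq_zero _).2 hA |> fun h => (h :
      (Lam ν b).mkQ A = 0), map_zero]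
  filter_upwards [hall] with p hp
  exact (Submodule.Quotient.mk_eq_zero _).1 (bs.ext_elem fun i => by simpa using hp i)

end Local

/-! ### Admissible test pairs from strong solutions -/

/-- The cutoff is S((j+1)t - 1) for a smooth step S. On the support of its derivative (j+1)t ≤ 2, so
η'_j(t) t is bounded by 2 sup |S'|, uniformly in j. -/
theorem exists_cutoff_zero : ∃ η η' : ℕ → ℝ → ℝ, (∀ j, ContDiff ℝ ∞ (η j)) ∧
    (∀ j, Continuous (η' j)) ∧ (∀ j t, HasDerivAt (η j) (η' j t) t) ∧
    (∀ j, ∃ s, 0 < s ∧ ∀ t < s, η j t = 0) ∧ (∀ j t, ‖η j t‖ ≤ 1) ∧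
    (∃ C, ∀ j t, |η' j t * t| ≤ C) ∧
    ∀ t, 0 < t → ∀ᶠ j in atTop, η j t = 1 ∧ η' j t = 0 := by
  set S := Real.smoothTransition with hS
  have hSd : ContDiff ℝ ∞ S := Real.smoothTransition.contDiff
  have hS1 : ∀ x, HasDerivAt S (deriv S x) x := fun x =>
    (hSd.differentiable (by simp) x).hasDerivAt
  have hS'c : Continuous (deriv S) := hSd.continuous_deriv (by simp)
  have hz : ∀ x, x ∉ Icc (0 : ℝ) 1 → deriv S x = 0 := fun x hx => by
    rw [mem_Icc, not_and_or, not_le, not_le] at hx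
    rcases hx with hx | hx
    · have : S =ᶠ[𝓝 x] fun _ => 0 := by
        filter_upwards [Iio_mem_nhds hx] with y hy
        exact Real.smoothTransition.zero_of_nonpos (le_of_lt hy)
      rw [this.deriv_eq, deriv_const]
    · have : S =ᶠ[𝓝 x] fun _ => 1 := by
        filter_upwards [Ioi_mem_nhds hx] with y hy
        exact Real.smoothTransition.one_of_one_le (le_of_lt hy)
      rw [this.deriv_eq, deriv_const]
  obtain ⟨M, hM⟩ := (isCompact_Icc (a := (0 : ℝ)) (b := 1)).exists_bound_of_continuousOn
    hS'c.continuousOn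
  have hM0 : 0 ≤ M := (norm_nonneg _).trans (hM 0 ⟨le_rfl, zero_le_one⟩)
  refine ⟨fun j t => S (((j : ℝ) + 1) * t - 1), fun j t => deriv S (((j : ℝ) + 1) * t - 1) *
    ((j : ℝ) + 1), fun j => hSd.comp (by fun_prop), fun j => by fun_prop, fun j t => ?_,
    fun j => ⟨1 / ((j : ℝ) + 1), by positivity, fun t ht => ?_⟩, fun j t => ?_,
    ⟨M * 2, fun j t => ?_⟩, fun t ht => ?_⟩
  · have h := (((hasDerivAt_id t).const_mul ((j : ℝ) + 1)).sub_const 1)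
    simp only [id, mul_one] at h
    exact (hS1 _).comp t h
  · refine Real.smoothTransition.zero_of_nonpos ?_
    rw [lt_div_iff₀ (by positivity)] at ht
    linarith
  · rw [Real.norm_of_nonneg (Real.smoothTransition.nonneg _)]
    exact Real.smoothTransition.le_one _
  · rw [mul_assoc]
    by_cases hx : ((j : ℝ) + 1) * t - 1 ∈ Icc (0 : ℝ) 1
    · rw [abs_mul]
      refine mul_le_mul (hM _ hx) ?_ (abs_nonneg _) hM0
      rw [abs_le]
      constructor <;> linarith [hx.1, hx.2]
    · rw [hz _ hx, zero_mul, abs_zero]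
      positivity
  · obtain ⟨j₀, hj₀⟩ := exists_nat_gt (2 / t)
    filter_upwards [eventually_ge_atTop j₀] with j hj
    have h1 : 2 / t < (j : ℝ) := hj₀.trans_le (by exact_mod_cast hj)
    rw [div_lt_iff₀ ht] at h1
    have h2 : 1 < ((j : ℝ) + 1) * t - 1 := by linarith
    exact ⟨Real.smoothTransition.one_of_one_le h2.le, by
      rw [hz _ fun h => absurd h.2 (not_le.2 h2), zero_mul]⟩

section

variable {d n N : ℕ} {ν : ℕ} {b : Coeff d n N}

/-- LΨ vanishes at t = 0 and has a bounded time derivative; the resulting factor t compensates the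
growth of η'_j in `constraint_of_weak`. -/
theorem SmoothMatField.exists_opL_bound {Ψ : ℝ → Torus d → Mat N} (hΨ : SmoothMatField Ψ)
    (h0 : ∀ x, Ψ 0 x = 0) (T : ℝ) :
    ∃ C, ∀ t ∈ Icc 0 T, ∀ x, ‖DualEntropy.opL ν b (Ψ t) x‖ ≤ C * t := by
  obtain ⟨C, hC⟩ := (hΨ.dtMat.opL ν b).exists_bound 0 T
  refine ⟨C, fun t ht x => ?_⟩
  have hz : DualEntropy.opL ν b (Ψ 0) x = 0 := by
    have : Ψ 0 = fun y => (0 : ℝ) • Ψ 0 y := by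
      ext y
      simp [h0 y]
    rw [this, opL_smul, zero_smul]
  have := norm_image_sub_le_of_norm_deriv_le_segment'
    (fun s (_ : s ∈ Icc 0 T) => (hΨ.hasDerivAt_opL ν b s x).hasDerivWithinAt)
    (fun s hs => hC s (Ico_subset_Icc_self hs) x) t ht
  rwa [hz, sub_zero, sub_zero] at this

theorem integrable_frob_of_bound {T C : ℝ} {A B : ℝ × Torus d → Mat N}
    (hA : ∀ l m, Integrable (fun p => A p l m) (spaceTime d 0 T))
    (hB : ∀ l m, AEStronglyMeasurable (fun p => B p l m) (spaceTime d 0 T))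
    (hBC : ∀ l m, ∀ᵐ p ∂spaceTime d 0 T, ‖B p l m‖ ≤ C) :
    Integrable (fun p => frob (A p) (B p)) (spaceTime d 0 T) := by
  unfold frob
  exact integrable_finsetSum _ fun l _ => integrable_finsetSum _ fun m _ =>
    (hA l m).mul_bdd (c := C) (hB l m) (hBC l m)

theorem integrable_inner_of_bound {T C : ℝ} {f w : ℝ × Torus d → E n}
    (hf : Integrable f (spaceTime d 0 T)) (hw : AEStronglyMeasurable w (spaceTime d 0 T))
    (hC : ∀ᵐ p ∂spaceTime d 0 T, ‖w p‖ ≤ C) :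
    Integrable (fun p => inner ℝ (f p) (w p)) (spaceTime d 0 T) := by
  refine Integrable.mono' (hf.norm.mul_const C) (hf.1.inner hw) ?_
  filter_upwards [hC] with p hp
  exact (norm_inner_le_norm _ _).trans (mul_le_mul_of_nonneg_left hp (norm_nonneg _))

/-- If `D = ∂_t f` and `G = L* f`, then `(∂_t (χ f), χ G)` satisfies the constraint for all smooth
functions `χ` of time that vanish near `T`; nothing is required at time `0`. -/
theorem constraint_of_weak {T T' : ℝ} (hT' : T' < T) {f D : ℝ × Torus d → E n}
    {G : ℝ × Torus d → Mat N} (hD : HasWeakTimeDeriv T f D) (hG : HasWeakLstar ν b T f G)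
    {χ χ' : ℝ → ℝ} (hχ : ContDiff ℝ ∞ χ) (hχ' : ∀ t, HasDerivAt χ (χ' t) t)
    (hχ'c : Continuous χ') (hχ0 : ∀ t, T' ≤ t → χ t = 0)
    (hfi : Integrable f (spaceTime d 0 T))
    (hDi : Integrable (fun p => χ p.1 • D p) (spaceTime d 0 T))
    (hGi : ∀ l m, Integrable (fun p => (χ p.1 • G p) l m) (spaceTime d 0 T)) :
    Constraint ν b T (fun p => χ' p.1 • f p + χ p.1 • D p) (fun p => χ p.1 • G p) := by
  intro Ψ hΨ hΨ0
  obtain ⟨η, η', hηs, hη'c, hηd, hηz, hη1, ⟨Cη, hηC⟩, hηlim⟩ := exists_cutoff_zero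
  have hmem : ∀ᵐ p ∂spaceTime d 0 T, p.1 ∈ Ioo 0 T := ae_fst_mem_spaceTime 0 T
  have hmem' : ∀ᵐ p ∂spaceTime d 0 T, p.1 ∈ Icc 0 T := hmem.mono fun p hp => Ioo_subset_Icc_self hp
  obtain ⟨CL, hCL⟩ := hΨ.exists_opL_bound (ν := ν) (b := b) hΨ0 T
  obtain ⟨Cχ, hCχ⟩ := (isCompact_Icc (a := (0 : ℝ)) (b := T)).exists_bound_of_continuousOn
    hχ.continuous.continuousOn
  obtain ⟨Cχ', hCχ'⟩ := (isCompact_Icc (a := (0 : ℝ)) (b := T)).exists_bound_of_continuousOn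
    hχ'c.continuousOn
  have hLs := hΨ.opL ν b
  have hLds := hΨ.dtMat.opL ν b
  obtain ⟨C1, hC1⟩ := hLs.exists_bound 0 T
  obtain ⟨C2, hC2⟩ := hLds.exists_bound 0 T
  have hLm : AEStronglyMeasurable (fun p : ℝ × Torus d => opL ν b (Ψ p.1) p.2)
    (spaceTime d 0 T) := hLs.continuous.aestronglyMeasurable
  have hLdm : AEStronglyMeasurable (fun p : ℝ × Torus d => opL ν b (dtMat Ψ p.1) p.2)
    (spaceTime d 0 T) := hLds.continuous.aestronglyMeasurable
  have hdtm : ∀ l m, AEStronglyMeasurable (fun p : ℝ × Torus d => dtMat Ψ p.1 p.2 l m)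
    (spaceTime d 0 T) := fun l m => (hΨ.dtMat.entry l m).continuous.aestronglyMeasurable
  have hdtb : ∃ C, ∀ l m, ∀ᵐ p ∂spaceTime d 0 T, ‖dtMat Ψ p.1 p.2 l m‖ ≤ C := by
    choose Cd hCd using fun l m => (hΨ.dtMat.entry l m).exists_bound 0 T
    refine ⟨∑ l, ∑ m, |Cd l m|, fun l m => ?_⟩
    filter_upwards [hmem'] with p hp
    refine (hCd l m p.1 hp p.2).trans ((le_abs_self _).trans ?_)
    refine (Finset.single_le_sum (f := fun m => |Cd l m|) (fun _ _ => abs_nonneg _)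
      (Finset.mem_univ m)).trans ?_
    exact Finset.single_le_sum (f := fun l => ∑ m, |Cd l m|)
      (fun _ _ => Finset.sum_nonneg fun _ _ => abs_nonneg _) (Finset.mem_univ l)
  obtain ⟨Cd, hCd⟩ := hdtb
  have hχfi : Integrable (fun p => χ p.1 • f p) (spaceTime d 0 T) :=
    hfi.bdd_smul Cχ (hχ.continuous.comp continuous_fst).aestronglyMeasurable
      (hmem'.mono fun p hp => hCχ _ hp)
  have hχ'fi : Integrable (fun p => χ' p.1 • f p) (spaceTime d 0 T) :=
    hfi.bdd_smul Cχ' (hχ'c.comp continuous_fst).aestronglyMeasurable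
      (hmem'.mono fun p hp => hCχ' _ hp)
  set A1 : ℝ × Torus d → ℝ := fun p => frob (χ p.1 • G p) (dtMat Ψ p.1 p.2) with hA1
  set A2 : ℝ × Torus d → ℝ := fun p => inner ℝ (χ' p.1 • f p) (opL ν b (Ψ p.1) p.2) with hA2
  set A3 : ℝ × Torus d → ℝ := fun p => inner ℝ (χ p.1 • D p) (opL ν b (Ψ p.1) p.2) with hA3
  set A4 : ℝ × Torus d → ℝ := fun p => inner ℝ (χ p.1 • f p) (opL ν b (dtMat Ψ p.1) p.2) with hA4
  have I1 : Integrable A1 (spaceTime d 0 T) := integrable_frob_of_bound hGi hdtm hCd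
  have I2 : Integrable A2 (spaceTime d 0 T) :=
    integrable_inner_of_bound hχ'fi hLm (hmem'.mono fun p hp => hC1 _ hp _)
  have I3 : Integrable A3 (spaceTime d 0 T) :=
    integrable_inner_of_bound hDi hLm (hmem'.mono fun p hp => hC1 _ hp _)
  have I4 : Integrable A4 (spaceTime d 0 T) :=
    integrable_inner_of_bound hχfi hLdm (hmem'.mono fun p hp => hC2 _ hp _)
  have hηI : ∀ j {A : ℝ × Torus d → ℝ}, Integrable A (spaceTime d 0 T) →
      Integrable (fun p => η j p.1 * A p) (spaceTime d 0 T) := fun j A hA =>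
    hA.bdd_mul ((hηs j).continuous.comp continuous_fst).aestronglyMeasurable
      (ae_of_all _ fun p => hη1 j p.1)
  -- The only term that contains the derivative of the cutoff. It is dominated uniformly in j,
  -- because |η'_j| t and ‖LΨ‖/t are bounded, and it tends to 0 pointwise.
  set R : ℕ → ℝ × Torus d → ℝ := fun j p => η' j p.1 *
    inner ℝ (χ p.1 • f p) (opL ν b (Ψ p.1) p.2) with hR
  have hRm : ∀ j, AEStronglyMeasurable (R j) (spaceTime d 0 T) := fun j =>
    ((hη'c j).comp continuous_fst).aestronglyMeasurable.mul (hχfi.1.inner hLm)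
  have hRb : ∀ j, ∀ᵐ p ∂spaceTime d 0 T, ‖R j p‖ ≤ ‖χ p.1 • f p‖ * (Cη * CL) := fun j => by
    filter_upwards [hmem] with p hp
    have h1 := hCL p.1 (Ioo_subset_Icc_self hp) p.2
    have h2 := hηC j p.1
    rw [hR, norm_mul, Real.norm_eq_abs]
    have h3 : |η' j p.1| * ‖opL ν b (Ψ p.1) p.2‖ ≤ Cη * CL := by
      rw [abs_mul, abs_of_pos hp.1] at h2
      have hCL0 : 0 ≤ CL := nonneg_of_mul_nonneg_left ((norm_nonneg _).trans h1) hp.1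
      calc |η' j p.1| * ‖opL ν b (Ψ p.1) p.2‖ ≤ |η' j p.1| * (CL * p.1) := by gcongr
        _ = |η' j p.1| * p.1 * CL := by ring
        _ ≤ Cη * CL := by gcongr
    calc |η' j p.1| * ‖inner ℝ (χ p.1 • f p) (opL ν b (Ψ p.1) p.2)‖
        ≤ |η' j p.1| * (‖χ p.1 • f p‖ * ‖opL ν b (Ψ p.1) p.2‖) := by
          gcongr
          exact norm_inner_le_norm _ _
      _ = ‖χ p.1 • f p‖ * (|η' j p.1| * ‖opL ν b (Ψ p.1) p.2‖) := by ring
      _ ≤ ‖χ p.1 • f p‖ * (Cη * CL) := by gcongr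
  have hRdom : Integrable (fun p => ‖χ p.1 • f p‖ * (Cη * CL)) (spaceTime d 0 T) :=
    hχfi.norm.mul_const _
  have hRi : ∀ j, Integrable (R j) (spaceTime d 0 T) := fun j => hRdom.mono' (hRm j) (hRb j)
  have hsum : Integrable (fun p => A1 p + A2 p + A3 p) (spaceTime d 0 T) := (I1.add I2).add I3
  -- G = L*f is tested with χ η_j ∂_tΨ, and ∂_t f = D with χ η_j LΨ. Since L commutes with ∂_t, the
  -- term `A4` occurs in both identities and drops out.
  have hzero : ∀ j, ∫ p, (η j p.1 * (A1 p + A2 p + A3 p) + R j p) ∂spaceTime d 0 T = 0 := by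
    intro j
    obtain ⟨s, hs, hs0⟩ := hηz j
    have hsupp : ∀ r, r ∉ Icc s T' → χ r * η j r = 0 := fun r hr => by
      rw [mem_Icc, not_and_or, not_le, not_le] at hr
      rcases hr with hr | hr
      · rw [hs0 r hr, mul_zero]
      · rw [hχ0 r hr.le, zero_mul]
    have h1 := hG.2.2 (fun t x => (χ t * η j t) • dtMat Ψ t x) (hΨ.dtMat.smul (hχ.mul (hηs j)))
      ⟨s, T', hs, hT', fun r hr x => by rw [hsupp r hr, zero_smul]⟩
    have h2 := hD.2 (fun t x => (χ t * η j t) • opL ν b (Ψ t) x) (hLs.smul (hχ.mul (hηs j)))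
      ⟨s, T', hs, hT', fun r hr x => by rw [hsupp r hr, zero_smul]⟩
    have e1 : ∫ p, η j p.1 * A1 p ∂spaceTime d 0 T = ∫ p, η j p.1 * A4 p ∂spaceTime d 0 T := by
      refine Eq.trans (integral_congr_ae (ae_of_all _ fun p => ?_)) (h1.trans
        (integral_congr_ae (ae_of_all _ fun p => ?_)))
      · simp only [hA1, frob_smul_left, frob_smul_right]
        ring
      · simp only [hA4, opL_smul, real_inner_smul_left, real_inner_smul_right]
        ring
    have e2 : ∫ p, (η j p.1 * A2 p + R j p + η j p.1 * A4 p) ∂spaceTime d 0 T =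
        -∫ p, η j p.1 * A3 p ∂spaceTime d 0 T := by
      refine Eq.trans (integral_congr_ae (ae_of_all _ fun p => ?_)) (h2.trans
        (congrArg Neg.neg (integral_congr_ae (ae_of_all _ fun p => ?_))))
      · dsimp only
        rw [(((hχ' p.1).fun_mul (hηd j p.1)).fun_smul (hΨ.hasDerivAt_opL ν b p.1 p.2)).deriv]
        simp only [hA2, hA4, hR, real_inner_smul_left, inner_add_right, real_inner_smul_right]
        ring
      · simp only [hA3, real_inner_smul_left, real_inner_smul_right]
        ring
    have hI2R : Integrable (fun p => η j p.1 * A2 p + R j p) (spaceTime d 0 T) :=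
      (hηI j I2).add (hRi j)
    rw [integral_add hI2R (hηI j I4), integral_add (hηI j I2) (hRi j)] at e2
    have hηS := hηI j hsum
    have hI12 : Integrable (fun p => η j p.1 * A1 p + η j p.1 * A2 p) (spaceTime d 0 T) :=
      (hηI j I1).add (hηI j I2)
    rw [integral_add hηS (hRi j)]
    simp only [mul_add]
    rw [integral_add hI12 (hηI j I3), integral_add (hηI j I1) (hηI j I2)]
    linarith
  have hlim : Tendsto (fun j => ∫ p, (η j p.1 * (A1 p + A2 p + A3 p) + R j p) ∂spaceTime d 0 T)
      atTop (𝓝 (∫ p, (A1 p + A2 p + A3 p) ∂spaceTime d 0 T)) := by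
    refine tendsto_integral_of_dominated_convergence
      (fun p => ‖A1 p + A2 p + A3 p‖ + ‖χ p.1 • f p‖ * (Cη * CL))
      (fun j => ((hηI j hsum).add (hRi j)).1) (hsum.norm.add hRdom) (fun j => ?_) ?_
    · filter_upwards [hRb j] with p hp
      refine (norm_add_le _ _).trans (add_le_add ?_ hp)
      rw [norm_mul]
      exact mul_le_of_le_one_left (norm_nonneg _) (hη1 j p.1)
    · filter_upwards [hmem] with p hp
      refine tendsto_const_nhds.congr' ?_
      filter_upwards [hηlim p.1 hp.1] with j hj
      simp only [hR, hj.1, hj.2, one_mul, zero_mul, add_zero]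
  simp only [hzero] at hlim
  have h0 := tendsto_nhds_unique hlim tendsto_const_nhds
  refine Eq.trans (integral_congr_ae (ae_of_all _ fun p => ?_)) h0
  simp only [hA1, hA2, hA3, inner_add_left]
  ring

end

/-! ### The flux -/

section Flux

variable {d n N : ℕ} {ν : ℕ} {b : Coeff d n N} {F : E n → Mat N}

/-- The derivative of the flux at `v` in the direction `w`. -/
noncomputable def fluxDeriv (F : E n → Mat N) (v w : E n) : Mat N :=
  Matrix.of fun l m => fderiv ℝ (fun x => F x l m) v w

theorem fluxDeriv_eq_sum (F : E n → Mat N) (v w : E n) :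
    fluxDeriv F v w = ∑ i, w i • partialF F i v := by
  ext l m
  rw [Matrix.sum_apply]
  simp only [fluxDeriv, partialF, Matrix.smul_apply, Matrix.of_apply, ← map_smul, ← map_sum]
  congr 1
  ext i
  simp [Pi.single_apply]

theorem inner_eq_neg_frob_fluxDeriv {v w D : E n} {G : Mat N}
    (h : ∀ i, D i + frob G (partialF F i v) = 0) :
    inner ℝ w D = -frob G (fluxDeriv F v w) := by
  have h1 : frob G (fluxDeriv F v w) = ∑ i, w i * frob G (partialF F i v) := by
    rw [fluxDeriv_eq_sum]
    induction (Finset.univ : Finset (Fin n)) using Finset.induction_on with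
    | empty => simp [frob]
    | insert i s hi ih =>
      rw [Finset.sum_insert hi, Finset.sum_insert hi, frob_add_right, frob_smul_right, ih]
  rw [h1, PiLp.inner_apply, ← Finset.sum_neg_distrib]
  refine Finset.sum_congr rfl fun i _ => ?_
  simp only [RCLike.inner_apply, conj_trivial]
  linear_combination w i * h i

theorem Admissible.hasFDerivAt_entry (hF : Admissible ν b F) (v : E n) (l m : Fin N) :
    HasFDerivAt (fun x => F x l m) (fderiv ℝ (fun x => F x l m) v) v :=
  ((hF.smooth l m).differentiable two_ne_zero v).hasFDerivAt

theorem Admissible.hasFDerivAt_frob (hF : Admissible ν b F) (P : Mat N) (v : E n) :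
    HasFDerivAt (fun x => frob (F x) P)
      (∑ l, ∑ m, (P l m) • fderiv ℝ (fun x => F x l m) v) v := by
  unfold frob
  exact HasFDerivAt.fun_sum fun l _ => HasFDerivAt.fun_sum fun m _ =>
    (hF.hasFDerivAt_entry v l m).mul_const (P l m)

theorem Admissible.fderiv_frob (hF : Admissible ν b F) (P : Mat N) (v w : E n) :
    fderiv ℝ (fun x => frob (F x) P) v w = frob (fluxDeriv F v w) P := by
  rw [(hF.hasFDerivAt_frob P v).fderiv]
  simp [frob, fluxDeriv, mul_comm]

theorem entropy_eq (F : E n → Mat N) :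
    entropy F = fun v => (1 / 2) * frob (F v) 1 - (1 / 2) * frob (F 0) 1 := by
  ext v
  rw [entropy, Matrix.trace_sub, frob_one_right, frob_one_right]
  ring

theorem Admissible.contDiff_entropy (hF : Admissible ν b F) : ContDiff ℝ 2 (entropy F) := by
  rw [entropy_eq]
  refine (contDiff_const.mul ?_).sub contDiff_const
  unfold frob
  exact ContDiff.sum fun l _ => ContDiff.sum fun m _ => (hF.smooth l m).mul contDiff_const

theorem Admissible.differentiable_entropy (hF : Admissible ν b F) :
    Differentiable ℝ (entropy F) :=
  hF.contDiff_entropy.differentiable two_ne_zero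

theorem Admissible.frob_fluxDeriv_one (hF : Admissible ν b F) (v w : E n) :
    frob (fluxDeriv F v w) 1 = 2 * inner ℝ (sharp F v) w := by
  rw [sharp, inner_gradient_left, entropy_eq,
    (((hF.hasFDerivAt_frob 1 v).const_mul (1 / 2)).sub_const _).fderiv, ← hF.fderiv_frob,
    (hF.hasFDerivAt_frob 1 v).fderiv]
  simp

/-- The bound |x_l x_m| ≤ (x_l² + x_m²)/2 controls the quadratic form of A by NM|x|². The shift
moves any element of Λ into the cone where the assumptions on F apply. -/
theorem posSemidef_add_smul_one {A : Mat N} (hA : A.IsSymm) {M : ℝ} (hM : ∀ l m, |A l m| ≤ M) :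
    (A + (N * M) • (1 : Mat N)).PosSemidef := by
  refine Matrix.PosSemidef.of_dotProduct_mulVec_nonneg ?_ fun x => ?_
  · rw [Matrix.IsHermitian, Matrix.conjTranspose_eq_transpose_of_trivial]
    exact hA.add (Matrix.isSymm_one.smul _)
  · have h1 : star x ⬝ᵥ (A + (N * M) • (1 : Mat N)).mulVec x =
        ∑ l, ∑ m, A l m * (x l * x m) + N * M * ∑ l, x l ^ 2 := by
      rw [Matrix.add_mulVec, dotProduct_add, Matrix.smul_mulVec, Matrix.one_mulVec,
        dotProduct_smul]
      simp only [dotProduct, Matrix.mulVec, star_trivial, smul_eq_mul, Finset.mul_sum]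
      congr 1
      · refine Finset.sum_congr rfl fun l _ => Finset.sum_congr rfl fun m _ => ?_
        ring
      · refine Finset.sum_congr rfl fun l _ => ?_
        ring
    have h2 : N * M * ∑ l, x l ^ 2 = ∑ l, ∑ m : Fin N, M * ((x l ^ 2 + x m ^ 2) / 2) := by
      simp only [← Finset.mul_sum, ← Finset.sum_div, Finset.sum_add_distrib, Finset.sum_const,
        Finset.card_univ, Fintype.card_fin, nsmul_eq_mul]
      ring
    rw [h1, h2, ← Finset.sum_add_distrib]
    refine Finset.sum_nonneg fun l _ => ?_
    rw [← Finset.sum_add_distrib]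
    refine Finset.sum_nonneg fun m _ => ?_
    have h3 : -(M * |x l * x m|) ≤ A l m * (x l * x m) := by
      have := neg_abs_le (A l m * (x l * x m))
      rw [abs_mul] at this
      have := mul_le_mul_of_nonneg_right (hM l m) (abs_nonneg (x l * x m))
      linarith
    have h4 : |x l * x m| ≤ (x l ^ 2 + x m ^ 2) / 2 := by
      rw [abs_le]
      constructor <;> nlinarith [sq_nonneg (x l + x m), sq_nonneg (x l - x m)]
    have := mul_le_mul_of_nonneg_left h4 ((abs_nonneg _).trans (hM l m))
    linarith

theorem one_mem_Lam : (1 : Mat N) ∈ Lam ν b := Submodule.subset_span (Or.inl rfl)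

theorem add_smul_one_mem_Lam {A : Mat N} (hA : A ∈ Lam ν b) (c : ℝ) :
    A + c • (1 : Mat N) ∈ Lam ν b :=
  (Lam ν b).add_mem hA ((Lam ν b).smul_mem c one_mem_Lam)

/-- Nonnegativity is applied to NM·I + A and NM·I - A. In the Λ directions the flux is thus
controlled by its trace, that is, by the entropy. -/
theorem Admissible.abs_frob_le (hF : Admissible ν b F) {A : Mat N} (hA : A ∈ Lam ν b) {M : ℝ}
    (hM : ∀ l m, |A l m| ≤ M) (v : E n) : |frob (F v) A| ≤ N * M * (F v).trace := by
  have h1 := hF.lamNonneg v _ (add_smul_one_mem_Lam hA _)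
    (posSemidef_add_smul_one (Lam_isSymm ν b hA) hM)
  have hA' : -A ∈ Lam ν b := (Lam ν b).neg_mem hA
  have h2 := hF.lamNonneg v _ (add_smul_one_mem_Lam hA' _)
    (posSemidef_add_smul_one (Lam_isSymm ν b hA') (M := M) fun l m => by simpa using hM l m)
  rw [← neg_one_smul ℝ A] at h2
  simp only [frob_add_right, frob_smul_right, frob_one_right] at h1 h2
  rw [abs_le]
  constructor <;> linarith

/-- The relative entropy `K(u) - K(v) - ∇K(v) · (u - v)`. -/
noncomputable def relEntropy (F : E n → Mat N) (u v : E n) : ℝ :=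
  entropy F u - entropy F v - inner ℝ (sharp F v) (u - v)

theorem relEntropy_add_relEntropy (F : E n → Mat N) (u v : E n) :
    relEntropy F u v + relEntropy F v u = inner ℝ (u - v) (sharp F u - sharp F v) := by
  simp only [relEntropy, inner_sub_right, real_inner_comm (sharp F u),
    real_inner_comm (sharp F v)]
  ring

theorem Admissible.relEntropy_nonneg (hF : Admissible ν b F) (u v : E n) :
    0 ≤ relEntropy F u v := by
  have := add_fderiv_le_of_convexOn hF.strictConvex.convexOn (hF.differentiable_entropy v) u
  rw [← inner_gradient_left] at this
  unfold relEntropy sharp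
  linarith

theorem Admissible.relEntropy_pos (hF : Admissible ν b F) {u v : E n} (h : u ≠ v) :
    0 < relEntropy F u v := by
  have := add_fderiv_lt_of_strictConvexOn hF.strictConvex (hF.differentiable_entropy v) h
  rw [← inner_gradient_left] at this
  unfold relEntropy sharp
  linarith

theorem Admissible.eq_of_inner_le (hF : Admissible ν b F) {u v : E n}
    (h : inner ℝ (u - v) (sharp F u - sharp F v) ≤ 0) : u = v := by
  by_contra hne
  rw [← relEntropy_add_relEntropy] at h
  linarith [hF.relEntropy_pos hne, hF.relEntropy_nonneg v u]

theorem Admissible.sharp_injective (hF : Admissible ν b F) : Function.Injective (sharp F) :=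
  fun u v h => hF.eq_of_inner_le (by rw [h, sub_self, inner_zero_right])

/-- The tangent inequality for the convex function F : (A + NM·I) at v. Because tr F is 2K up to a
constant, the part with I contributes exactly 2NM times the relative entropy. -/
theorem Admissible.neg_relEntropy_le (hF : Admissible ν b F) {A : Mat N} (hA : A ∈ Lam ν b)
    {M : ℝ} (hM : ∀ l m, |A l m| ≤ M) (u v : E n) :
    -(2 * (N * M) * relEntropy F u v) ≤
      frob (F u) A - frob (F v) A - frob A (fluxDeriv F v (u - v)) := by
  have h1 := hF.lamConvex _ (add_smul_one_mem_Lam hA _)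
    (posSemidef_add_smul_one (Lam_isSymm ν b hA) hM)
  have h2 := add_fderiv_le_of_convexOn h1 (hF.hasFDerivAt_frob _ v).differentiableAt u
  rw [hF.fderiv_frob] at h2
  simp only [frob_add_right, frob_smul_right, hF.frob_fluxDeriv_one] at h2
  rw [frob_comm (fluxDeriv F v (u - v)) A] at h2
  have h3 : 2 * relEntropy F u v =
      frob (F u) 1 - frob (F v) 1 - 2 * inner ℝ (sharp F v) (u - v) := by
    rw [relEntropy, entropy_eq]
    ring
  linear_combination h2 - N * M * h3

end Flux

/-! ### Test pairs -/

section Uniqueness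

variable {d n N : ℕ} {ν : ℕ} {b : Coeff d n N} {F : E n → Mat N}

theorem Admissible.memOrlicz_sharp (hF : Admissible ν b F) {X : Type*} [MeasurableSpace X]
    {μ : Measure X} [IsFiniteMeasure μ] {v : X → E n} (hv : MemOrlicz (entropy F) v μ) :
    MemOrlicz (legendre (entropy F)) (fun x => sharp F (v x)) μ :=
  hv.gradient hF.nFunction hF.deltaTwo (hF.contDiff_entropy.of_le (by norm_num))

theorem MemLinftySym.exists_bound {T : ℝ} {B : ℝ × Torus d → Mat N} (hB : MemLinftySym T B) :
    ∃ C, ∀ᵐ p ∂spaceTime d 0 T, ∀ l m, |B p l m| ≤ C := by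
  have h : ∀ l m, ∃ C, ∀ᵐ p ∂spaceTime d 0 T, |B p l m| ≤ C := fun l m => by
    have hfin := (hB.2 l m).2
    rw [eLpNorm_exponent_top] at hfin
    refine ⟨(eLpNormEssSup (fun p => B p l m) (spaceTime d 0 T)).toReal, ?_⟩
    filter_upwards [ae_le_eLpNormEssSup (f := fun p => B p l m)] with p hp
    have := ENNReal.toReal_mono hfin.ne hp
    rwa [toReal_enorm] at this
  choose C hC using h
  refine ⟨∑ l, ∑ m, |C l m|, ?_⟩
  have hall : ∀ᵐ p ∂spaceTime d 0 T, ∀ l m, |B p l m| ≤ C l m :=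
    ae_all_iff.2 fun l => ae_all_iff.2 fun m => hC l m
  filter_upwards [hall] with p hp l m
  refine (hp l m).trans ((le_abs_self _).trans ?_)
  refine (Finset.single_le_sum (f := fun m => |C l m|) (fun _ _ => abs_nonneg _)
    (Finset.mem_univ m)).trans ?_
  exact Finset.single_le_sum (f := fun l => ∑ m, |C l m|)
    (fun _ _ => Finset.sum_nonneg fun _ _ => abs_nonneg _) (Finset.mem_univ l)

/-- A strong solution yields test pairs `(∂_t (χ v#), χ L* v#)` for all smooth `χ` that vanish
near `T`. -/
theorem IsStrongSolution.exists_test_pair (hF : Admissible ν b F) {T T' : ℝ} (hT' : T' < T)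
    {k : ℝ → ℝ} (hk : IsWeight T k) {v₀ : Torus d → E n} {v : ℝ × Torus d → E n}
    (hv : IsStrongSolution ν b F T k v₀ v) :
    ∃ (D : ℝ × Torus d → E n) (G : ℝ × Torus d → Mat N) (M : ℝ), 0 ≤ M ∧
      (∀ᵐ p ∂spaceTime d 0 T, G p ∈ Lam ν b) ∧
      (∀ᵐ p ∂spaceTime d 0 T, p.1 < T' → ∀ l m, |G p l m| ≤ M) ∧
      (∀ᵐ p ∂spaceTime d 0 T, ∀ l, D p l + frob (G p) (partialF F l (v p)) = 0) ∧
      ∀ χ χ' : ℝ → ℝ, ContDiff ℝ ∞ χ → (∀ t, HasDerivAt χ (χ' t) t) → Continuous χ' →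
        (∀ t, T' ≤ t → χ t = 0) →
        MemOrlicz (legendre (entropy F)) (fun p => χ' p.1 • sharp F (v p) + χ p.1 • D p)
          (spaceTime d 0 T) ∧
        MemLinftySym T (fun p => χ p.1 • G p) ∧
        Constraint ν b T (fun p => χ' p.1 • sharp F (v p) + χ p.1 • D p)
          (fun p => χ p.1 • G p) := by
  obtain ⟨D, G, hD, hG, hGb, heq⟩ := hv.equation
  obtain ⟨g, hg, hgo⟩ := hv.timeReg
  have hK := hF.nFunction
  have hf := hF.memOrlicz_sharp hv.weak.1
  have hprod := weakTimeDeriv_tailWeight hk hD hg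
  obtain ⟨κ, hκc, hκ⟩ := hk.exists_continuous_tailWeight
  obtain ⟨c, hc, hcκ⟩ := hk.mul_le_tailWeight
  obtain ⟨C, hC⟩ := hGb.exists_bound
  have hmem : ∀ᵐ p ∂spaceTime d 0 T, p.1 ∈ Ioo 0 T := ae_fst_mem_spaceTime 0 T
  have hκpos : ∀ t ∈ Ioo 0 T, 0 < κ t := fun t ht => by
    rw [← hκ t (Ioo_subset_Icc_self ht)]
    exact (mul_pos hc (sub_pos.2 ht.2)).trans_le (hcκ t (Ioo_subset_Icc_self ht))
  have hκlow : ∀ t ∈ Ioo 0 T, t < T' → c * (T - T') ≤ κ t := fun t ht htT => by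
    rw [← hκ t (Ioo_subset_Icc_self ht)]
    refine le_trans ?_ (hcκ t (Ioo_subset_Icc_self ht))
    gcongr
  have hm0 : 0 < c * (T - T') := mul_pos hc (sub_pos.2 hT')
  refine ⟨D, G, |C| / (c * (T - T')), by positivity, hG.ae_mem_Lam, ?_, heq,
    fun χ χ' hχ hχ' hχ'c hχ0 => ?_⟩
  · filter_upwards [hC, hmem] with p hp hpt hpT l m
    have h1 := hp l m
    rw [Matrix.smul_apply, smul_eq_mul, hκ _ (Ioo_subset_Icc_self hpt), abs_mul,
      abs_of_pos (hκpos _ hpt)] at h1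
    rw [le_div_iff₀ hm0, mul_comm]
    refine le_trans ?_ (h1.trans (le_abs_self C))
    exact mul_le_mul_of_nonneg_right (hκlow _ hpt hpT) (abs_nonneg _)
  obtain ⟨Cχ, hCχ⟩ := (isCompact_Icc (a := (0 : ℝ)) (b := T)).exists_bound_of_continuousOn
    hχ.continuous.continuousOn
  obtain ⟨Cχ', hCχ'⟩ := (isCompact_Icc (a := (0 : ℝ)) (b := T)).exists_bound_of_continuousOn
    hχ'c.continuousOn
  -- The quotient χ/κ is bounded: χ vanishes from T' on, and κ ≥ c(T - T') before. The product rule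
  -- gives χD = (χ/κ)(g + k v#), which transfers the weighted regularity to χD; χG is treated in the
  -- same way.
  have ham : AEStronglyMeasurable (fun p : ℝ × Torus d => χ p.1 / κ p.1) (spaceTime d 0 T) :=
    ((hχ.continuous.measurable.div hκc.measurable).comp measurable_fst).aestronglyMeasurable
  have hab : ∀ᵐ p ∂spaceTime d 0 T, |χ p.1 / κ p.1| ≤ |Cχ| / (c * (T - T')) := by
    filter_upwards [hmem] with p hp
    rcases lt_or_ge p.1 T' with h | h
    · rw [abs_div, abs_of_pos (hκpos _ hp)]
      exact div_le_div₀ (abs_nonneg _) ((hCχ _ (Ioo_subset_Icc_self hp)).trans (le_abs_self _))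
        hm0 (hκlow _ hp h)
    · rw [hχ0 _ h, zero_div, abs_zero]
      positivity
  obtain ⟨c₁, C₁, hc₁, hC₁⟩ := hk.2
  have hkm : AEStronglyMeasurable (fun p : ℝ × Torus d => k p.1) (spaceTime d 0 T) :=
    aestronglyMeasurable_fst (hk.1.mono_measure (Measure.restrict_mono_set _ Ioo_subset_Icc_self))
  have hkb : ∀ᵐ p ∂spaceTime d 0 T, |k p.1| ≤ C₁ := by
    filter_upwards [hmem] with p hp
    have := hC₁ _ (Ioo_subset_Icc_self hp)
    rw [abs_of_nonneg (hc₁.le.trans this.1)]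
    exact this.2
  have hχD : ∀ᵐ p ∂spaceTime d 0 T,
      (χ p.1 / κ p.1) • (g p + k p.1 • sharp F (v p)) = χ p.1 • D p := by
    filter_upwards [hprod, hmem] with p hp hpt
    rw [hp, sub_add_cancel, hκ _ (Ioo_subset_Icc_self hpt), smul_smul,
      div_mul_cancel₀ _ (hκpos _ hpt).ne']
  have hχDo : MemOrlicz (legendre (entropy F)) (fun p => χ p.1 • D p) (spaceTime d 0 T) :=
    ((hgo.add hF.deltaTwo_conj hK.legendre_convexOn hK.legendre_nonneg
      (hf.smul hF.deltaTwo_conj hK.legendre_convexOn hK.legendre_nonneg hK.legendre_neg hkm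
        hkb)).smul hF.deltaTwo_conj hK.legendre_convexOn hK.legendre_nonneg hK.legendre_neg ham
        hab).congr hχD
  have heo : MemOrlicz (legendre (entropy F)) (fun p => χ' p.1 • sharp F (v p) + χ p.1 • D p)
      (spaceTime d 0 T) :=
    (hf.smul hF.deltaTwo_conj hK.legendre_convexOn hK.legendre_nonneg hK.legendre_neg
      (hχ'c.comp continuous_fst).aestronglyMeasurable
      (hmem.mono fun p hp => hCχ' _ (Ioo_subset_Icc_self hp))).add
      hF.deltaTwo_conj hK.legendre_convexOn hK.legendre_nonneg hχDo
  have hχG : ∀ l m, MemLp (fun p => (χ p.1 • G p) l m) ⊤ (spaceTime d 0 T) := fun l m => by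
    have h1 : (fun p : ℝ × Torus d => (χ p.1 / κ p.1) * (tailWeight T k p.1 • G p) l m)
        =ᵐ[spaceTime d 0 T] fun p => (χ p.1 • G p) l m := by
      filter_upwards [hmem] with p hpt
      rw [Matrix.smul_apply, Matrix.smul_apply, hκ _ (Ioo_subset_Icc_self hpt), smul_eq_mul,
        smul_eq_mul, ← mul_assoc, div_mul_cancel₀ _ (hκpos _ hpt).ne']
    refine MemLp.ae_eq h1 (memLp_top_of_bound (ham.mul (hGb.2 l m).1)
      (|Cχ| / (c * (T - T')) * C) ?_)
    filter_upwards [hab, hC] with p hp1 hp2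
    rw [norm_mul]
    exact mul_le_mul hp1 (hp2 l m) (norm_nonneg _) (by positivity)
  refine ⟨heo, ⟨hG.1.mono fun p hp => hp.smul _, hχG⟩, ?_⟩
  exact constraint_of_weak hT' hD hG hχ hχ' hχ'c hχ0 (hf.integrable_legendre hK)
    (hχDo.integrable_legendre hK) fun l m => (hχG l m).integrable le_top

theorem Admissible.integrable_frob_flux (hF : Admissible ν b F) {T : ℝ}
    {u : ℝ × Torus d → E n} (hu : MemOrlicz (entropy F) u (spaceTime d 0 T))
    {B : ℝ × Torus d → Mat N} (hB : MemLinftySym T B)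
    (hBL : ∀ᵐ p ∂spaceTime d 0 T, B p ∈ Lam ν b) :
    Integrable (fun p => frob (F (u p)) (B p)) (spaceTime d 0 T) := by
  obtain ⟨C, hC⟩ := hB.exists_bound
  have htr : ∀ v, (F v).trace = 2 * entropy F v + (F 0).trace := fun v => by
    rw [entropy, Matrix.trace_sub]
    ring
  refine Integrable.mono' ((((hu.2.const_mul 2).add (integrable_const (F 0).trace))).const_mul
    (N * C)) ?_ ?_
  · unfold frob
    have hsum : ∀ {ι : Type} (s : Finset ι) (f : ι → ℝ × Torus d → ℝ),
        (∀ i, AEStronglyMeasurable (f i) (spaceTime d 0 T)) →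
        AEStronglyMeasurable (fun p => ∑ i ∈ s, f i p) (spaceTime d 0 T) := fun s f hf =>
      s.aestronglyMeasurable_fun_sum fun i _ => hf i
    exact hsum _ _ fun l => hsum _ _ fun m =>
      ((hF.smooth l m).continuous.comp_aestronglyMeasurable hu.1).mul (hB.2 l m).1
  · filter_upwards [hC, hBL] with p h1 h2
    refine (hF.abs_frob_le h2 h1 (u p)).trans_eq ?_
    rw [htr]
    rfl

/-- The weak formulation as an integral identity between integrable functions. -/
theorem IsWeakSolution.integrable_and_eq (hF : Admissible ν b F) {T : ℝ} {v₀ : Torus d → E n}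
    (hv₀ : MemOrlicz (entropy F) v₀ volume) {u : ℝ × Torus d → E n}
    (hu : IsWeakSolution ν b F T v₀ u) {e : ℝ × Torus d → E n} {B : ℝ × Torus d → Mat N}
    (he : MemOrlicz (legendre (entropy F)) e (spaceTime d 0 T)) (hB : MemLinftySym T B)
    (hBL : ∀ᵐ p ∂spaceTime d 0 T, B p ∈ Lam ν b) (hc : Constraint ν b T e B) :
    Integrable (fun p => inner ℝ (u p - v₀ p.2) (e p) + frob (F (u p)) (B p))
      (spaceTime d 0 T) ∧
    ∫ p, (inner ℝ (u p - v₀ p.2) (e p) + frob (F (u p)) (B p)) ∂spaceTime d 0 T = 0 := by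
  refine ⟨Integrable.add ?_ (hF.integrable_frob_flux hu.1 hB hBL), hu.2 e B he hB hc⟩
  have h0 : MemOrlicz (entropy F) (fun p : ℝ × Torus d => v₀ p.2) (spaceTime d 0 T) :=
    ⟨hv₀.1.comp_snd, hv₀.2.comp_snd _⟩
  simp only [inner_sub_left]
  exact (hu.1.integrable_inner hF.nFunction he).sub (h0.integrable_inner hF.nFunction he)

/-! ### The relative entropy argument -/

/-- The factor exp(-γt) produces -γχ, and the other factor is nonincreasing in t, so it only lowers
the derivative. This plays the role of Gronwall's inequality. -/
theorem exists_decreasing_cutoff (T' γ : ℝ) : ∃ χ χ' : ℝ → ℝ, ContDiff ℝ ∞ χ ∧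
    (∀ t, HasDerivAt χ (χ' t) t) ∧ Continuous χ' ∧ (∀ t, T' ≤ t → χ t = 0) ∧
    (∀ t, t < T' → 0 < χ t) ∧ ∀ t, χ' t ≤ -(γ * χ t) := by
  set χ : ℝ → ℝ := fun t => expNegInvGlue (T' - t) * Real.exp (-(γ * t)) with hχ
  have hs : ContDiff ℝ ∞ χ :=
    (expNegInvGlue.contDiff.comp (contDiff_const.sub contDiff_id)).mul
      (Real.contDiff_exp.comp (contDiff_const.mul contDiff_id).neg)
  have hd : ∀ t, HasDerivAt χ (-deriv expNegInvGlue (T' - t) * Real.exp (-(γ * t)) +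
      expNegInvGlue (T' - t) * (Real.exp (-(γ * t)) * -γ)) t := fun t => by
    have h1 : HasDerivAt expNegInvGlue (deriv expNegInvGlue (T' - t)) (T' - t) :=
      ((expNegInvGlue.contDiff (n := 1)).differentiable one_ne_zero _).hasDerivAt
    have h2 : HasDerivAt (fun t => T' - t) (-1) t := by
      simpa using (hasDerivAt_id t).const_sub T'
    have h3 := h1.comp t h2
    rw [mul_neg_one] at h3
    have h4 : HasDerivAt (fun t => -(γ * t)) (-γ) t := by
      simpa using ((hasDerivAt_id t).const_mul γ).fun_neg
    exact h3.mul h4.exp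
  refine ⟨χ, deriv χ, hs, fun t => (hd t).differentiableAt.hasDerivAt,
    hs.continuous_deriv (by simp), fun t ht => ?_, fun t ht => ?_, fun t => ?_⟩
  · rw [hχ]
    dsimp only
    rw [expNegInvGlue.zero_of_nonpos (sub_nonpos.2 ht), zero_mul]
  · exact mul_pos (expNegInvGlue.pos_of_pos (sub_pos.2 ht)) (Real.exp_pos _)
  · rw [(hd t).deriv]
    have h1 : 0 ≤ deriv expNegInvGlue (T' - t) := expNegInvGlue.monotone.deriv_nonneg
    have h2 := mul_nonneg h1 (Real.exp_pos (-(γ * t))).le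
    rw [hχ]
    dsimp only
    linarith

theorem ae_eq_of_lt (hF : Admissible ν b F) {T T' : ℝ} (hT' : T' < T) {k : ℝ → ℝ}
    (hk : IsWeight T k) {v₀ : Torus d → E n} (hv₀ : MemOrlicz (entropy F) v₀ volume)
    {u v : ℝ × Torus d → E n} (hu : IsStrongSolution ν b F T k v₀ u)
    (hv : IsStrongSolution ν b F T k v₀ v) :
    ∀ᵐ p ∂spaceTime d 0 T, p.1 < T' → u p = v p := by
  obtain ⟨Du, Gu, Mu, hMu0, hGuL, hGuM, hequ, htu⟩ := hu.exists_test_pair hF hT' hk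
  obtain ⟨Dv, Gv, Mv, hMv0, hGvL, hGvM, heqv, htv⟩ := hv.exists_test_pair hF hT' hk
  set M := max Mu Mv with hM
  obtain ⟨χ, χ', hχ, hχ', hχ'c, hχ0, hχpos, hχγ⟩ :=
    -- The part 2NM of the rate absorbs the convexity defect of both fluxes; the extra 1 leaves χS
    -- as a lower bound.
    exists_decreasing_cutoff T' (2 * (N * M) + 1)
  obtain ⟨heu, hBu, hcu⟩ := htu χ χ' hχ hχ' hχ'c hχ0
  obtain ⟨hev, hBv, hcv⟩ := htv χ χ' hχ hχ' hχ'c hχ0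
  have hBuL : ∀ᵐ p ∂spaceTime d 0 T, χ p.1 • Gu p ∈ Lam ν b :=
    hGuL.mono fun p hp => (Lam ν b).smul_mem _ hp
  have hBvL : ∀ᵐ p ∂spaceTime d 0 T, χ p.1 • Gv p ∈ Lam ν b :=
    hGvL.mono fun p hp => (Lam ν b).smul_mem _ hp
  obtain ⟨iuv, Wuv⟩ := hu.weak.integrable_and_eq hF hv₀ hev hBv hBvL hcv
  obtain ⟨iuu, Wuu⟩ := hu.weak.integrable_and_eq hF hv₀ heu hBu hBuL hcu
  obtain ⟨ivv, Wvv⟩ := hv.weak.integrable_and_eq hF hv₀ hev hBv hBvL hcv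
  obtain ⟨ivu, Wvu⟩ := hv.weak.integrable_and_eq hF hv₀ heu hBu hBuL hcu
  -- The alternating sum of the four weak integrands. Keeping these grouped makes J integrable at
  -- once; the terms with F' appear only in the pointwise identity `hJp` and need not be integrable
  -- one by one.
  set J : ℝ × Torus d → ℝ := fun p =>
    ((inner ℝ (u p - v₀ p.2) (χ' p.1 • sharp F (v p) + χ p.1 • Dv p) +
        frob (F (u p)) (χ p.1 • Gv p)) -
      (inner ℝ (u p - v₀ p.2) (χ' p.1 • sharp F (u p) + χ p.1 • Du p) +
        frob (F (u p)) (χ p.1 • Gu p))) -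
    ((inner ℝ (v p - v₀ p.2) (χ' p.1 • sharp F (v p) + χ p.1 • Dv p) +
        frob (F (v p)) (χ p.1 • Gv p)) -
      (inner ℝ (v p - v₀ p.2) (χ' p.1 • sharp F (u p) + χ p.1 • Du p) +
        frob (F (v p)) (χ p.1 • Gu p))) with hJ
  have hJi : Integrable J (spaceTime d 0 T) := (iuv.sub iuu).sub (ivv.sub ivu)
  have hJ0 : ∫ p, J p ∂spaceTime d 0 T = 0 := by
    have h1 := integral_sub (iuv.sub iuu) (ivv.sub ivu)
    have h2 := integral_sub iuv iuu
    have h3 := integral_sub ivv ivu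
    simp only [Pi.sub_apply] at h1
    rw [hJ, h1, h2, h3, Wuv, Wuu, Wvv, Wvu]
    ring
  have hlow : ∀ᵐ p ∂spaceTime d 0 T,
      χ p.1 * inner ℝ (u p - v p) (sharp F (u p) - sharp F (v p)) ≤ J p := by
    filter_upwards [hGuL, hGvL, hGuM, hGvM, hequ, heqv] with p hp1 hp2 hp3 hp4 hp5 hp6
    set S := inner ℝ (u p - v p) (sharp F (u p) - sharp F (v p)) with hS
    have hS' := relEntropy_add_relEntropy F (u p) (v p)
    have hSnn : 0 ≤ S := by
      rw [hS, ← hS']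
      exact add_nonneg (hF.relEntropy_nonneg _ _) (hF.relEntropy_nonneg _ _)
    have hDv := inner_eq_neg_frob_fluxDeriv (w := u p - v p) hp6
    have hDu := inner_eq_neg_frob_fluxDeriv (w := v p - u p) hp5
    have hJp : J p = -χ' p.1 * S + χ p.1 *
        ((frob (F (u p)) (Gv p) - frob (F (v p)) (Gv p) -
            frob (Gv p) (fluxDeriv F (v p) (u p - v p))) +
          (frob (F (v p)) (Gu p) - frob (F (u p)) (Gu p) -
            frob (Gu p) (fluxDeriv F (u p) (v p - u p)))) := by
      rw [← neg_eq_iff_eq_neg.2 hDv, ← neg_eq_iff_eq_neg.2 hDu]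
      simp only [hJ, hS, inner_sub_left, inner_sub_right, inner_add_right, real_inner_smul_right,
        frob_smul_right]
      ring
    rw [hJp]
    have h7 := mul_le_mul_of_nonneg_right (hχγ p.1) hSnn
    rcases lt_or_ge p.1 T' with h | h
    · have h8 := hF.neg_relEntropy_le hp2 (M := M)
        (fun l m => (hp4 h l m).trans (le_max_right _ _)) (u p) (v p)
      have h9 := hF.neg_relEntropy_le hp1 (M := M)
        (fun l m => (hp3 h l m).trans (le_max_left _ _)) (v p) (u p)
      have h10 := mul_le_mul_of_nonneg_left (add_le_add h8 h9) (hχpos _ h).le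
      have h11 : χ p.1 * (-(2 * (N * M) * relEntropy F (u p) (v p)) +
          -(2 * (N * M) * relEntropy F (v p) (u p))) = -(2 * (N * M) * χ p.1 * S) := by
        rw [hS, ← hS']
        ring
      linarith
    -- From T' on there is no bound on L*(u#) and L*(v#), but χ = 0 there and only -χ'S ≥ 0 is left.
    · rw [hχ0 _ h] at h7 ⊢
      linarith
  have hSnn : ∀ p, 0 ≤ inner ℝ (u p - v p) (sharp F (u p) - sharp F (v p)) := fun p => by
    rw [← relEntropy_add_relEntropy]
    exact add_nonneg (hF.relEntropy_nonneg _ _) (hF.relEntropy_nonneg _ _)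
  have hχnn : ∀ t, 0 ≤ χ t := fun t => by
    rcases lt_or_ge t T' with h | h
    · exact (hχpos t h).le
    · rw [hχ0 t h]
  have hJnn : 0 ≤ᵐ[spaceTime d 0 T] J := hlow.mono fun p hp =>
    (mul_nonneg (hχnn p.1) (hSnn p)).trans hp
  have hJz := (integral_eq_zero_iff_of_nonneg_ae hJnn hJi).1 hJ0
  filter_upwards [hlow, hJz] with p h1 h2 hpT
  rw [h2] at h1
  exact hF.eq_of_inner_le (nonpos_of_mul_nonpos_right h1 (hχpos _ hpT))

theorem ae_eq_of_isStrongSolution (hF : Admissible ν b F) {T : ℝ} {k : ℝ → ℝ}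
    (hk : IsWeight T k) {v₀ : Torus d → E n} (hv₀ : MemOrlicz (entropy F) v₀ volume)
    {u v : ℝ × Torus d → E n} (hu : IsStrongSolution ν b F T k v₀ u)
    (hv : IsStrongSolution ν b F T k v₀ v) : ∀ᵐ p ∂spaceTime d 0 T, u p = v p := by
  have hall : ∀ᵐ p ∂spaceTime d 0 T, ∀ j : ℕ, p.1 < T - 1 / ((j : ℝ) + 1) → u p = v p :=
    ae_all_iff.2 fun j => ae_eq_of_lt hF (by
      have : (0 : ℝ) < 1 / ((j : ℝ) + 1) := by positivity
      linarith) hk hv₀ hu hv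
  filter_upwards [hall, ae_fst_mem_spaceTime (d := d) 0 T] with p hp hpt
  obtain ⟨j, hj⟩ := exists_nat_one_div_lt (sub_pos.2 hpt.2)
  exact hp j (by linarith)

/-! ### From almost every time to every time -/

theorem MemOrlicz.sub_legendre (hF : Admissible ν b F) {X : Type*} [MeasurableSpace X]
    {μ : Measure X} [IsFiniteMeasure μ] {f g : X → E n}
    (hf : MemOrlicz (legendre (entropy F)) f μ) (hg : MemOrlicz (legendre (entropy F)) g μ) :
    MemOrlicz (legendre (entropy F)) (fun x => f x - g x) μ := by
  have hK := hF.nFunction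
  have hneg : MemOrlicz (legendre (entropy F)) (fun x => -g x) μ :=
    ⟨hg.1.neg, by simpa only [hK.legendre_neg] using hg.2⟩
  simpa only [sub_eq_add_neg] using
    hf.add hF.deltaTwo_conj hK.legendre_convexOn hK.legendre_nonneg hneg

/-- U and V agree at almost every time, so there are such times s arbitrarily close to t from the
right, also when t = 0. There U#(t) - V#(t) = (V#(s) - V#(t)) - (U#(s) - U#(t)), and both
differences are small in Luxemburg norm. -/
theorem IsTimeRep.ae_eq (hF : Admissible ν b F) {T : ℝ} {u v : ℝ × Torus d → E n}
    (huv : ∀ᵐ p ∂spaceTime d 0 T, u p = v p) {U V : ℝ → Torus d → E n}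
    (hU : IsTimeRep F T u U) (hV : IsTimeRep F T v V) {t : ℝ} (ht : t ∈ Ico 0 T) :
    ∀ᵐ x : Torus d, U t x = V t x := by
  have hK := hF.nFunction
  have hae : ∀ᵐ s ∂volume.restrict (Ioo 0 T), ∀ᵐ x : Torus d, U s x = V s x := by
    filter_upwards [hU.1, hV.1, Measure.ae_ae_of_ae_prod huv] with s h1 h2 h3
    filter_upwards [h1, h2, h3] with x h1 h2 h3
    rw [h1, h2, h3]
  have key : ∀ᵐ x : Torus d, sharp F (U t x) - sharp F (V t x) = 0 := by
    refine ae_eq_of_luxNorm_lt hK.legendre_convexOn hK.legendre_nonneg hK.legendre_zero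
      hK.legendre_neg (fun y => hK.legendre_pos) ((hU.2.1 t ht).1.sub (hV.2.1 t ht).1)
      fun r hr => ?_
    have hev := ((hU.2.2 t ht).eventually_lt_const hr).and
      ((hV.2.2 t ht).eventually_lt_const hr)
    obtain ⟨δ, hδ, hball⟩ := Metric.mem_nhdsWithin_iff.1 hev
    have hne : ∃ s ∈ Ioo t (min (t + δ) T), ∀ᵐ x : Torus d, U s x = V s x := by
      by_contra hcon
      have hsub : Ioo t (min (t + δ) T) ⊆ Ioo 0 T := fun s hs =>
        ⟨ht.1.trans_lt hs.1, hs.2.trans_le (min_le_right _ _)⟩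
      have h1 := ae_restrict_of_ae_restrict_of_subset hsub hae
      rw [ae_restrict_iff' measurableSet_Ioo] at h1
      have h2 : ∀ᵐ s : ℝ, s ∉ Ioo t (min (t + δ) T) := by
        filter_upwards [h1] with s hs hs'
        exact hcon ⟨s, hs', hs hs'⟩
      have h3 : volume (Ioo t (min (t + δ) T)) = 0 := by
        rw [ae_iff] at h2
        simpa only [not_not, ofPred_mem_eq] using h2
      rw [Real.volume_Ioo, ENNReal.ofReal_eq_zero, sub_nonpos] at h3
      exact absurd h3 (not_le.2 (lt_min (by linarith) ht.2))
    obtain ⟨s, hs, hsUV⟩ := hne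
    have hsT : s ∈ Ico 0 T := ⟨ht.1.trans hs.1.le, hs.2.trans_le (min_le_right _ _)⟩
    have hsb : s ∈ Metric.ball t δ := by
      rw [Metric.mem_ball, Real.dist_eq, abs_of_pos (sub_pos.2 hs.1)]
      linarith [hs.2.trans_le (min_le_left (t + δ) T)]
    obtain ⟨hl1, hl2⟩ := hball ⟨hsb, hsT⟩
    refine ⟨_, _, (hU.2.1 s hsT).sub_legendre hF (hU.2.1 t ht),
      (hV.2.1 s hsT).sub_legendre hF (hV.2.1 t ht), hl1, hl2, ?_⟩
    filter_upwards [hsUV] with x hx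
    rw [hx]
    abel
  filter_upwards [key] with x hx
  exact hF.sharp_injective (sub_eq_zero.1 hx)

end Uniqueness

end DualEntropy

-- The two existence clauses ensure that the assertion about all time-continuous representatives is
-- not vacuous.
open DualEntropy MeasureTheory in
theorem mainTheorem4 {d n N : ℕ} (ν : ℕ) (b : Coeff d n N) (F : E n → Mat N)
    (hF : Admissible ν b F) (T : ℝ) (hT : 0 < T) (k : ℝ → ℝ) (hk : IsWeight T k)
    (v₀ : Torus d → E n) (hv₀ : MemOrlicz (entropy F) v₀ volume)
    (u v : ℝ × Torus d → E n)
    (hu : IsStrongSolution ν b F T k v₀ u) (hv : IsStrongSolution ν b F T k v₀ v) :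
    (∃ U, IsTimeRep F T u U) ∧ (∃ V, IsTimeRep F T v V) ∧
      ∀ U V : ℝ → Torus d → E n, IsTimeRep F T u U → IsTimeRep F T v V →
        ∀ t ∈ Set.Ico 0 T, ∀ᵐ x : Torus d, U t x = V t x := by
  obtain ⟨U, hU, -⟩ := hu.initial
  obtain ⟨V, hV, -⟩ := hv.initial
  exact ⟨⟨U, hU⟩, ⟨V, hV⟩, fun U V hU hV t ht =>
    hU.ae_eq hF (ae_eq_of_isStrongSolution hF hk hv₀ hu hv) hV ht⟩
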